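/- Let $d\in\mathbb N$, $\mathbb T^d=(\mathbb R/\mathbb Z)^d$, $X=\mathbb T^d\times\mathbb R^d\times(0,\infty)$ with points $z=(x,v,\theta)$, and let $\phi,\zeta:\mathbb T^d\to\mathbb R$ be Lipschitz continuous. For a nonnegative Radon measure $\mu$ on $X$ with compact support put $$F[\mu](x,v,\theta)=\int_X\phi(x-x_*)\Big(\frac{v_*}{\theta_*}-\frac v\theta\Big)\mu(dz_*),\qquad G[\mu](x,\theta)=\int_X\zeta(x-x_*)\Big(\frac1\theta-\frac1{\theta_*}\Big)\mu(dz_*).$$ A family $(\mu_t)_{t\in[0,T]}$ of nonnegative Radon measures on $X$ with $\operatorname{ess\,sup}_t\mu_t(X)<\infty$ is a measure-valued solution of the kinetic thermomechanical Cucker–Smale equation $$\partial_tf+v\cdot\nabla_xf+\nabla_v\cdot(F[f]f)+\partial_\theta(G[f]f)=0$$ if (i) $t\mapsto\int_X g\,d\mu_t$ is continuous on $[0,T]$ for every $g\in C_0(X)$, and (ii) for every $C^1$ function $g$ with compact support in $[0,T)\times X$ and every $t\in[0,T)$, $$\int_X g(t,\cdot)\,d\mu_t-\int_X g(0,\cdot)\,d\mu_0=\int_0^t\int_X\big(\partial_sg+v\cdot\nabla_xg+F[\mu_s]\cdot\nabla_vg+G[\mu_s]\,\partial_\theta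 g\big)\,d\mu_s\,ds.$$ The bounded Lipschitz distance is $d(\mu,\nu)=\sup_{g\in\Omega}\big|\int_Xg\,d\mu-\int_Xg\,d\nu\big|$, where $\Omega$ is the set of $g:X\to\mathbb R$ with $\|g\|_{L^\infty}\le1$ and Lipschitz constant at most $1$ (for the Euclidean product distance on $X$). Let $T,P_T,\theta_m^0,\theta_M^0>0$ and $M\ge0$. Then there is a constant $C_T>0$, depending only on $d,\phi,\zeta,T,P_T,\theta_m^0,\theta_M^0,M$, such that for any two measure-valued solutions $\mu,\nu$ on $[0,T]$ with $\mu_0(X),\nu_0(X)\le M$ and $$\operatorname{supp}\mu_t,\ \operatorname{supp}\nu_t\subset\mathbb T^d\times\overline{B_{P_T}(0)}\times[\theta_m^0,\theta_M^0]\qquad\text{for all }t\in[0,T],$$ one has $$d(\mu_t,\nu_t)\le C_T\,d(\mu_0,\nu_0)\qquad\text{for all }t\in[0,T].$$ -/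

import Mathlib

open MeasureTheory Set
open scoped NNReal ENNReal ZeroAtInfty

noncomputable section

namespace TCS

/-- The phase space `X = 𝕋^d × ℝ^d × ℝ_+` of positions, velocities and (positive) temperatures,
with `𝕋^d = (ℝ/ℤ)^d` and `ℝ_+ = (0, ∞)`. -/
abbrev Phase (d : ℕ) : Type :=
  UnitAddTorus (Fin d) × EuclideanSpace ℝ (Fin d) × Ioi (0 : ℝ)

/-- The covering map `ℝ^d → 𝕋^d`. -/
def toTorus {d : ℕ} (y : EuclideanSpace ℝ (Fin d)) : UnitAddTorus (Fin d) :=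
  fun i => (y i : UnitAddCircle)

/-- The Euclidean product distance on `X`; on the torus it is the flat distance, since
`‖x i - x' i‖` is the distance of `x i` and `x' i` on the circle `ℝ/ℤ`. -/
def phaseDist {d : ℕ} (z z' : Phase d) : ℝ :=
  Real.sqrt ((∑ i, ‖z.1 i - z'.1 i‖ ^ 2) + ‖z.2.1 - z'.2.1‖ ^ 2
    + ((z.2.2 : ℝ) - (z'.2.2 : ℝ)) ^ 2)

/-- The class `Ω` of functions on `X` that are bounded by `1` and `1`-Lipschitz. -/
def blClass (d : ℕ) : Set (Phase d → ℝ) :=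
  {g | (∀ z, |g z| ≤ 1) ∧ ∀ z z', |g z - g z'| ≤ phaseDist z z'}

/-- The bounded Lipschitz distance of two (finite) measures on `X`. -/
def blDist {d : ℕ} (μ ν : Measure (Phase d)) : ℝ≥0∞ :=
  ⨆ g ∈ blClass d, ENNReal.ofReal |∫ z, g z ∂μ - ∫ z, g z ∂ν|

/-- `F[μ](x, v, θ) = ∫ φ(x - x_*) (v_* / θ_* - v / θ) μ(dz_*)`. -/
def force {d : ℕ} (φ : UnitAddTorus (Fin d) → ℝ) (μ : Measure (Phase d)) (z : Phase d) :
    EuclideanSpace ℝ (Fin d) :=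
  ∫ w, φ (z.1 - w.1) • ((w.2.2 : ℝ)⁻¹ • w.2.1 - (z.2.2 : ℝ)⁻¹ • z.2.1) ∂μ

/-- `G[μ](x, θ) = ∫ ζ(x - x_*) (1 / θ - 1 / θ_*) μ(dz_*)`. -/
def heating {d : ℕ} (ζ : UnitAddTorus (Fin d) → ℝ) (μ : Measure (Phase d)) (z : Phase d) : ℝ :=
  ∫ w, ζ (z.1 - w.1) * ((z.2.2 : ℝ)⁻¹ - (w.2.2 : ℝ)⁻¹) ∂μ

/-- A function of time and phase, written in the coordinates `(s, x, v, θ)` with `x` in the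
universal cover `ℝ^d` of the torus. Only its values at `θ > 0` matter. -/
def inCoords {d : ℕ} (g : ℝ → Phase d → ℝ)
    (q : ℝ × EuclideanSpace ℝ (Fin d) × EuclideanSpace ℝ (Fin d) × ℝ) : ℝ :=
  if h : 0 < q.2.2.2 then g q.1 (toTorus q.2.1, q.2.2.1, ⟨q.2.2.2, h⟩) else 0

/-- `C¹` test functions with compact support in `(-∞, T) × X`. Their restrictions to `[0, T) × X`
are exactly the `C¹` functions with compact support in `[0, T) × X`. -/
structure IsTest {d : ℕ} (T : ℝ) (g : ℝ → Phase d → ℝ) : Prop where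
  contDiffOn : ContDiffOn ℝ 1 (inCoords g) {q | 0 < q.2.2.2}
  hasCompactSupport : HasCompactSupport (Function.uncurry g)
  tsupport_subset : tsupport (Function.uncurry g) ⊆ Iio T ×ˢ univ

/-- The time derivative `∂_s g`. -/
def dTime {d : ℕ} (g : ℝ → Phase d → ℝ) (s : ℝ) (z : Phase d) : ℝ :=
  deriv (fun r => g r z) s

/-- The gradient `∇_x g` in the position variable on the torus. -/
def gradPos {d : ℕ} (g : ℝ → Phase d → ℝ) (s : ℝ) (z : Phase d) : EuclideanSpace ℝ (Fin d) :=
  gradient (fun y : EuclideanSpace ℝ (Fin d) => g s (z.1 + toTorus y, z.2)) 0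

/-- The gradient `∇_v g` in the velocity variable. -/
def gradVel {d : ℕ} (g : ℝ → Phase d → ℝ) (s : ℝ) (z : Phase d) : EuclideanSpace ℝ (Fin d) :=
  gradient (fun w : EuclideanSpace ℝ (Fin d) => g s (z.1, w, z.2.2)) z.2.1

/-- The derivative `∂_θ g` in the temperature variable. -/
def dTemp {d : ℕ} (g : ℝ → Phase d → ℝ) (s : ℝ) (z : Phase d) : ℝ :=
  deriv (fun r : ℝ => if h : 0 < r then g s (z.1, z.2.1, ⟨r, h⟩) else 0) (z.2.2 : ℝ)

/-- `t ↦ μ t`, `t ∈ [0, T]`, is a measure-valued solution, with initial measure `μ 0`, of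
`∂_t f + v · ∇_x f + ∇_v · (F[f] f) + ∂_θ (G[f] f) = 0`. Values of `μ` at times outside `[0, T]`
are irrelevant. -/
structure IsMeasureValuedSolution {d : ℕ} (φ ζ : UnitAddTorus (Fin d) → ℝ) (T : ℝ)
    (μ : ℝ → Measure (Phase d)) : Prop where
  /-- each `μ t` is a Radon measure -/
  radon : ∀ t ∈ Icc 0 T, (μ t).Regular
  /-- the total mass is essentially bounded in time -/
  essBounded : ∃ K : ℝ≥0, ∀ᵐ t ∂(volume.restrict (Icc 0 T)), μ t univ ≤ K
  /-- weak continuity in time, tested on continuous functions that vanish at infinity -/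
  weaklyContinuous : ∀ g : C₀(Phase d, ℝ), ContinuousOn (fun t => ∫ z, g z ∂(μ t)) (Icc 0 T)
  /-- the equation in the sense of distributions -/
  equation : ∀ g : ℝ → Phase d → ℝ, IsTest T g → ∀ t ∈ Ico 0 T,
    ∫ z, g t z ∂(μ t) - ∫ z, g 0 z ∂(μ 0) =
      ∫ s in (0 : ℝ)..t, ∫ z, (dTime g s z + inner ℝ z.2.1 (gradPos g s z)
        + inner ℝ (force φ (μ s) z) (gradVel g s z)
        + heating ζ (μ s) z * dTemp g s z) ∂(μ s)

/-- The set `𝕋^d × B_P(0) × [θm, θM]`, with the closed ball. -/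
def box (d : ℕ) (P θm θM : ℝ) : Set (Phase d) :=
  {z | z.2.1 ∈ Metric.closedBall 0 P ∧ (z.2.2 : ℝ) ∈ Icc θm θM}

end TCS

end

/-! Lift the equation to the cover `ℝ^d × ℝ^d × ℝ`. On the common support box, `v` and `1/θ` agree
with bounded Lipschitz truncations. The lifted measures therefore solve a continuity equation whose
field is a bounded Lipschitz drift plus the integral of a bounded Lipschitz kernel, tested against
functions periodic in position. Such a field is Lipschitz in space, and in the measure it is
Lipschitz for the bounded Lipschitz distance.

Stability is proved by duality with explicit Euler steps, without constructing characteristics. Over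
a short time `δ`, the integral of `f` against the solution changes, up to `O(δ²)`, as if `f` were
replaced by `f(z + δ c(z))`, where `c` is the field frozen at the initial time. The Taylor expansion
needs test functions with Lipschitz derivative, so the distance is first taken over 1-bounded,
1-Lipschitz functions whose derivative is `A`-Lipschitz. Here `A` comes from mollification at radius
`ε`. Mollifying the field at the same radius makes its derivative `l A`-Lipschitz, `l` being its
Lipschitz constant, so composition with the Euler map enlarges all three bounds by at most a factor
`1 + (3l + l²)δ` that does not involve `A` (`IsC11.comp_euler`).

Both solutions are compared through the same Euler map; the difference of their fields is bounded by
the distance itself (`IsKernel.norm_field_sub_le`). This gives a differential inequality with rate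
independent of `ε` and an error `O(ε)` (`IsWeakSol.abs_integral_sub_le_step`). The terms containing
`A` are of order `δ²` and vanish in the difference quotient. Gronwall and then `ε → 0` give
`IsWeakSol.stability`; `IsMeasureValuedSolution.isWeakSol` connects it to the original equation. -/

open Filter Topology
open scoped Convolution
set_option linter.unusedSectionVars false

namespace TCS

/-! ### Periodic bounded Lipschitz functions and their mollification -/

section Mollification

variable {V : Type*} [NormedAddCommGroup V] [NormedSpace ℝ V]
variable {W : Type*} [NormedAddCommGroup W] [NormedSpace ℝ W]

/-- Functions bounded by `B`, Lipschitz with constant `L` and invariant under the translations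
in `Λ`. -/
structure IsBL (Λ : Set V) (B L : ℝ) (f : V → W) : Prop where
  norm_le : ∀ x, ‖f x‖ ≤ B
  lip : ∀ x y, ‖f x - f y‖ ≤ L * ‖x - y‖
  periodic : ∀ p ∈ Λ, ∀ x, f (x + p) = f x

/-- Differentiable functions in the class `IsBL` whose derivative is Lipschitz with
constant `A`. -/
structure IsC11 (Λ : Set V) (B L A : ℝ) (f : V → W) : Prop extends IsBL Λ B L f where
  differentiable : Differentiable ℝ f
  lip_fderiv : ∀ x y, ‖fderiv ℝ f x - fderiv ℝ f y‖ ≤ A * ‖x - y‖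

variable {Λ : Set V} {B L A : ℝ} {f : V → W}

theorem continuous_of_lip (h : ∀ x y, ‖f x - f y‖ ≤ L * ‖x - y‖) : Continuous f := by
  refine (LipschitzWith.of_dist_le_mul (K := L.toNNReal) fun x y => ?_).continuous
  rw [dist_eq_norm, dist_eq_norm]
  exact (h x y).trans (mul_le_mul_of_nonneg_right (Real.le_coe_toNNReal L) (norm_nonneg _))

theorem IsBL.continuous (h : IsBL Λ B L f) : Continuous f := continuous_of_lip h.lip

theorem IsBL.bound_nonneg (h : IsBL Λ B L f) : 0 ≤ B := (norm_nonneg _).trans (h.norm_le 0)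

theorem IsBL.mono {B' L' : ℝ} (h : IsBL Λ B L f) (hB : B ≤ B') (hL : L ≤ L') :
    IsBL Λ B' L' f where
  norm_le x := (h.norm_le x).trans hB
  lip x y := (h.lip x y).trans (mul_le_mul_of_nonneg_right hL (norm_nonneg _))
  periodic := h.periodic

theorem IsBL.const_smul (h : IsBL Λ B L f) (c : ℝ) :
    IsBL Λ (|c| * B) (|c| * L) (fun x => c • f x) where
  norm_le x := by
    rw [norm_smul, Real.norm_eq_abs]
    exact mul_le_mul_of_nonneg_left (h.norm_le x) (abs_nonneg c)
  lip x y := by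
    rw [← smul_sub, norm_smul, Real.norm_eq_abs, mul_assoc]
    exact mul_le_mul_of_nonneg_left (h.lip x y) (abs_nonneg c)
  periodic p hp x := by rw [h.periodic p hp]

theorem IsBL.add {B' L' : ℝ} {g : V → W} (h : IsBL Λ B L f) (h' : IsBL Λ B' L' g) :
    IsBL Λ (B + B') (L + L') (fun x => f x + g x) where
  norm_le x := (norm_add_le _ _).trans (add_le_add (h.norm_le x) (h'.norm_le x))
  lip x y := by
    have e : f x + g x - (f y + g y) = (f x - f y) + (g x - g y) := by abel
    rw [e, add_mul]
    exact (norm_add_le _ _).trans (add_le_add (h.lip x y) (h'.lip x y))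
  periodic p hp x := by rw [h.periodic p hp, h'.periodic p hp]

theorem IsC11.mono {B' L' A' : ℝ} (h : IsC11 Λ B L A f) (hB : B ≤ B') (hL : L ≤ L')
    (hA : A ≤ A') : IsC11 Λ B' L' A' f where
  toIsBL := h.toIsBL.mono hB hL
  differentiable := h.differentiable
  lip_fderiv x y := (h.lip_fderiv x y).trans (mul_le_mul_of_nonneg_right hA (norm_nonneg _))

theorem IsC11.const_smul (h : IsC11 Λ B L A f) (c : ℝ) :
    IsC11 Λ (|c| * B) (|c| * L) (|c| * A) (fun x => c • f x) where
  toIsBL := h.toIsBL.const_smul c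
  differentiable := h.differentiable.const_smul c
  lip_fderiv x y := by
    have e : ∀ x, fderiv ℝ (fun x => c • f x) x = c • fderiv ℝ f x := fun x =>
      fderiv_fun_const_smul (h.differentiable x) c
    rw [e, e, ← smul_sub, norm_smul, Real.norm_eq_abs, mul_assoc]
    exact mul_le_mul_of_nonneg_left (h.lip_fderiv x y) (abs_nonneg c)

theorem IsC11.continuous_fderiv (h : IsC11 Λ B L A f) : Continuous (fderiv ℝ f) :=
  continuous_of_lip h.lip_fderiv

theorem IsC11.contDiff (h : IsC11 Λ B L A f) : ContDiff ℝ 1 f :=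
  contDiff_one_iff_fderiv.2 ⟨h.differentiable, h.continuous_fderiv⟩

theorem IsC11.norm_fderiv_le (h : IsC11 Λ B L A f) (hL : 0 ≤ L) (x : V) :
    ‖fderiv ℝ f x‖ ≤ L :=
  norm_fderiv_le_of_lip' ℝ hL (Eventually.of_forall fun y => h.lip y x)

theorem IsC11.fderiv_periodic (h : IsC11 Λ B L A f) (p : V) (hp : p ∈ Λ) (x : V) :
    fderiv ℝ f (x + p) = fderiv ℝ f x := by
  rw [← fderiv_comp_add_right]
  exact congrArg (fun g => fderiv ℝ g x) (funext (h.periodic p hp))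

/-- First order Taylor estimate. -/
theorem IsC11.taylor (h : IsC11 Λ B L A f) (hA : 0 ≤ A) (x u : V) :
    ‖f (x + u) - f x - fderiv ℝ f x u‖ ≤ A * ‖u‖ ^ 2 := by
  have key := (convex_closedBall x ‖u‖).norm_image_sub_le_of_norm_hasFDerivWithin_le'
    (f := f) (f' := fderiv ℝ f) (φ := fderiv ℝ f x) (C := A * ‖u‖) (x := x) (y := x + u)
    (fun z _ => (h.differentiable z).hasFDerivAt.hasFDerivWithinAt)
    (fun z hz => (h.lip_fderiv z x).trans
      (mul_le_mul_of_nonneg_left (by rwa [← mem_closedBall_iff_norm]) hA))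
    (Metric.mem_closedBall_self (norm_nonneg _)) (by simp)
  rw [add_sub_cancel_left] at key
  exact key.trans_eq (by ring)

variable [FiniteDimensional ℝ V] [MeasurableSpace V] [BorelSpace V]

/-- The gradient bound of the mollifier, which controls the Lipschitz constant of the derivative
of a mollified Lipschitz function. -/
noncomputable def mollConst (ρ : ContDiffBump (0 : V)) : ℝ :=
  ∫ u, ‖fderiv ℝ (ρ.normed (Measure.addHaar : Measure V)) u‖ ∂Measure.addHaar

theorem mollConst_nonneg (ρ : ContDiffBump (0 : V)) : 0 ≤ mollConst ρ :=
  integral_nonneg fun _ => norm_nonneg _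

/-- Mollification of a bounded Lipschitz periodic function. -/
theorem IsBL.mollify [CompleteSpace W] (h : IsBL Λ B L f) (hL : 0 ≤ L)
    (ρ : ContDiffBump (0 : V)) :
    ∃ g : V → W, IsC11 Λ B L (L * mollConst ρ) g ∧ ∀ x, ‖g x - f x‖ ≤ L * ρ.rOut := by
  set m : Measure V := Measure.addHaar
  set r : V → ℝ := ρ.normed m
  have hr : Continuous r := ρ.continuous_normed
  have hrs : HasCompactSupport r := ρ.hasCompactSupport_normed
  have hr1 : ContDiff ℝ 1 r := ρ.contDiff_normed
  have hr0 : ∀ u, 0 ≤ r u := fun u => ρ.nonneg_normed u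
  have hri : Integrable r m := ρ.integrable_normed
  have hrI : ∫ u, r u ∂m = 1 := ρ.integral_normed
  have hf := h.continuous
  have hD : Continuous (fderiv ℝ r) := hr1.continuous_fderiv one_ne_zero
  have hDi : Integrable (fderiv ℝ r) m := hD.integrable_of_hasCompactSupport (hrs.fderiv ℝ)
  have hinteg : ∀ x, Integrable (fun u => r u • f (x - u)) m := fun x =>
    (hr.smul (hf.comp (continuous_const.sub continuous_id))).integrable_of_hasCompactSupport
      hrs.smul_right
  have hinteg' : ∀ x, Integrable (fun u => ((ContinuousLinearMap.lsmul ℝ ℝ :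
      ℝ →L[ℝ] W →L[ℝ] W).precompL V) (fderiv ℝ r u) (f (x - u))) m := fun x =>
    (hrs.fderiv ℝ).convolutionExists_left_of_continuous_right _ hDi.locallyIntegrable hf x
  have hder : ∀ x, HasFDerivAt (r ⋆[ContinuousLinearMap.lsmul ℝ ℝ, m] f)
      ((fderiv ℝ r ⋆[(ContinuousLinearMap.lsmul ℝ ℝ).precompL V, m] f) x) x := fun x =>
    hrs.hasFDerivAt_convolution_left _ hr1 hf.locallyIntegrable x
  have hpc : ∀ (T : V →L[ℝ] ℝ) (w : W), ‖((ContinuousLinearMap.lsmul ℝ ℝ :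
      ℝ →L[ℝ] W →L[ℝ] W).precompL V) T w‖ ≤ ‖T‖ * ‖w‖ := by
    intro T w
    refine ContinuousLinearMap.opNorm_le_bound _ (by positivity) fun x => ?_
    simp only [ContinuousLinearMap.precompL_apply, ContinuousLinearMap.lsmul_apply, norm_smul]
    calc ‖T x‖ * ‖w‖ ≤ (‖T‖ * ‖x‖) * ‖w‖ := by gcongr; exact T.le_opNorm x
      _ = _ := by ring
  refine ⟨r ⋆[ContinuousLinearMap.lsmul ℝ ℝ, m] f, ⟨⟨fun x => ?_, fun x y => ?_,
    fun p hp x => ?_⟩, fun x => (hder x).differentiableAt, fun x y => ?_⟩, fun x => ?_⟩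
  · simp only [convolution_def, ContinuousLinearMap.lsmul_apply]
    calc ‖∫ u, r u • f (x - u) ∂m‖ ≤ ∫ u, r u * B ∂m := by
          refine norm_integral_le_of_norm_le (hri.mul_const _) (Eventually.of_forall fun u => ?_)
          rw [norm_smul, Real.norm_of_nonneg (hr0 u)]
          exact mul_le_mul_of_nonneg_left (h.norm_le _) (hr0 u)
      _ = B := by rw [integral_mul_const, hrI, one_mul]
  · simp only [convolution_def, ContinuousLinearMap.lsmul_apply]
    rw [← integral_sub (hinteg x) (hinteg y)]
    calc ‖∫ u, r u • f (x - u) - r u • f (y - u) ∂m‖ ≤ ∫ u, r u * (L * ‖x - y‖) ∂m := by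
          refine norm_integral_le_of_norm_le (hri.mul_const _) (Eventually.of_forall fun u => ?_)
          rw [← smul_sub, norm_smul, Real.norm_of_nonneg (hr0 u)]
          refine mul_le_mul_of_nonneg_left ((h.lip _ _).trans_eq ?_) (hr0 u)
          rw [sub_sub_sub_cancel_right]
      _ = L * ‖x - y‖ := by rw [integral_mul_const, hrI, one_mul]
  · simp only [convolution_def]
    congr 1
    ext u
    rw [show x + p - u = x - u + p by abel, h.periodic p hp]
  -- The derivative falls on the mollifier and the difference on `f`, so the constant is `L` times a
  -- quantity depending only on the bump. The same factor thus serves test functions and vector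
  -- fields.
  · rw [(hder x).fderiv, (hder y).fderiv, convolution_def, convolution_def,
      ← integral_sub (hinteg' x) (hinteg' y)]
    calc _ ≤ ∫ u, ‖fderiv ℝ r u‖ * (L * ‖x - y‖) ∂m := by
          refine norm_integral_le_of_norm_le (hDi.norm.mul_const _)
            (Eventually.of_forall fun u => ?_)
          rw [← map_sub]
          refine (hpc _ _).trans (mul_le_mul_of_nonneg_left ((h.lip _ _).trans_eq ?_)
            (norm_nonneg _))
          rw [sub_sub_sub_cancel_right]
      _ = L * mollConst ρ * ‖x - y‖ := by
          rw [integral_mul_const]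
          change mollConst ρ * _ = _
          ring
  · rw [← dist_eq_norm]
    refine ρ.dist_normed_convolution_le hf.aestronglyMeasurable fun y hy => ?_
    rw [dist_eq_norm]
    refine (h.lip _ _).trans (mul_le_mul_of_nonneg_left ?_ hL)
    rw [← dist_eq_norm]
    exact (Metric.mem_ball.1 hy).le

end Mollification

/-! ### Mean fields and weak solutions on a finite-dimensional space -/

section Stability

variable {V : Type*} [NormedAddCommGroup V] [NormedSpace ℝ V]
variable [FiniteDimensional ℝ V] [MeasurableSpace V] [BorelSpace V]
variable {Λ : Set V} {B L : ℝ}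

theorem IsBL.integrable {W : Type*} [NormedAddCommGroup W] [NormedSpace ℝ W] {f : V → W}
    [SecondCountableTopologyEither V W] (h : IsBL Λ B L f) (m : Measure V) [IsFiniteMeasure m] :
    Integrable f m :=
  Integrable.of_bound h.continuous.aestronglyMeasurable B (Eventually.of_forall h.norm_le)

/-- `D` bounds the differences of the integrals of the functions in the unit bounded Lipschitz
class. -/
def BLBound (Λ : Set V) (m n : Measure V) (D : ℝ) : Prop :=
  ∀ h : V → ℝ, IsBL Λ 1 1 h → |∫ z, h z ∂m - ∫ z, h z ∂n| ≤ D

/-- Dividing by `B + L` puts `h` into the unit class; if this sum vanishes, then `h = 0`. -/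
theorem BLBound.apply {m n : Measure V} {D : ℝ} (hD : BLBound Λ m n D) {h : V → ℝ}
    (hh : IsBL Λ B L h) (hL : 0 ≤ L) : |∫ z, h z ∂m - ∫ z, h z ∂n| ≤ (B + L) * D := by
  have hB := hh.bound_nonneg
  rcases (add_nonneg hB hL).eq_or_lt with h0 | h0
  · have hz : h = fun _ => 0 := by
      ext z
      have := hh.norm_le z
      have hB0 : B = 0 := by linarith
      rw [hB0] at this
      exact norm_le_zero_iff.1 this
    simp [hz, ← h0]
  · have h1 : IsBL Λ 1 1 fun z => (B + L)⁻¹ • h z := by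
      refine (hh.const_smul _).mono ?_ ?_ <;>
      · rw [abs_of_pos (inv_pos.2 h0), inv_mul_le_one₀ h0]
        linarith
    have := hD _ h1
    rw [integral_smul, integral_smul, ← smul_sub, smul_eq_mul, abs_mul,
      abs_of_pos (inv_pos.2 h0), inv_mul_le_iff₀ h0] at this
    exact this

/-- A bounded Lipschitz periodic drift and a bounded Lipschitz biperiodic interaction kernel. -/
structure IsKernel (Λ : Set V) (B L : ℝ) (b : V → V) (k : V → V → V) : Prop where
  nonneg : 0 ≤ L
  drift : IsBL Λ B L b
  left : ∀ w, IsBL Λ B L (fun z => k z w)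
  right : ∀ z, IsBL Λ B L (k z)

/-- The mean field generated by a measure. -/
noncomputable def field (b : V → V) (k : V → V → V) (m : Measure V) (z : V) : V :=
  b z + ∫ w, k z w ∂m

variable {b : V → V} {k : V → V → V}

theorem IsKernel.field_isBL (hk : IsKernel Λ B L b k) {m : Measure V} [IsFiniteMeasure m]
    {M : ℝ} (hM : m.real univ ≤ M) :
    IsBL Λ (B * (1 + M)) (L * (1 + M)) (field b k m) := by
  have hB := hk.drift.bound_nonneg
  have hL := hk.nonneg
  have hi : IsBL Λ (B * M) (L * M) (fun z => ∫ w, k z w ∂m) := by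
    refine ⟨fun z => ?_, fun z z' => ?_, fun p hp z => ?_⟩
    · exact (norm_integral_le_of_norm_le_const (Eventually.of_forall (hk.right z).norm_le)).trans
        (mul_le_mul_of_nonneg_left hM hB)
    · rw [← integral_sub ((hk.right z).integrable m) ((hk.right z').integrable m)]
      refine (norm_integral_le_of_norm_le_const
        (Eventually.of_forall fun w => (hk.left w).lip z z')).trans ?_
      rw [mul_right_comm]
      gcongr
    · exact integral_congr_ae (Eventually.of_forall fun w => (hk.left w).periodic p hp z)
  exact (hk.drift.add hi).mono (by ring_nf; rfl) (by ring_nf; rfl)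

/-- The drift cancels. Pairing the difference with a norming functional of norm at most one turns
the kernel into an admissible scalar test function. -/
theorem IsKernel.norm_field_sub_le (hk : IsKernel Λ B L b k) {m n : Measure V}
    [IsFiniteMeasure m] [IsFiniteMeasure n] {D : ℝ} (hD : BLBound Λ m n D) (z : V) :
    ‖field b k m z - field b k n z‖ ≤ (B + L) * D := by
  obtain ⟨ℓ, hℓ, he⟩ := exists_dual_vector'' ℝ (field b k m z - field b k n z)
  have h1 : IsBL Λ B L fun w => ℓ (k z w) := by
    have := (hk.right z)
    refine ⟨fun w => ?_, fun w w' => ?_, fun p hp w => by rw [this.periodic p hp]⟩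
    · exact (ℓ.le_of_opNorm_le hℓ _).trans (by rw [one_mul]; exact this.norm_le w)
    · rw [← map_sub]
      exact (ℓ.le_of_opNorm_le hℓ _).trans (by rw [one_mul]; exact this.lip w w')
  have h2 := hD.apply h1 hk.nonneg
  have h3 : (‖field b k m z - field b k n z‖ : ℝ)
      = ∫ w, ℓ (k z w) ∂m - ∫ w, ℓ (k z w) ∂n := by
    rw [ℓ.integral_comp_comm ((hk.right z).integrable m),
      ℓ.integral_comp_comm ((hk.right z).integrable n), ← map_sub]
    refine Eq.trans ?_ (he.symm.trans ?_)
    · simp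
    · simp [field]
  rw [h3]
  exact (le_abs_self _).trans h2

/-- Product rule for Lipschitz constants. The constant `A` enters the Lipschitz bound but not the
sup bound. -/
theorem IsC11.apply_isBL {A B' L' : ℝ} {f : V → ℝ} (hf : IsC11 Λ B 1 A f) (hA : 0 ≤ A)
    (hb : IsBL Λ B' L' b) : IsBL Λ B' (A * B' + L') (fun z => fderiv ℝ f z (b z)) := by
  have hn := hf.norm_fderiv_le zero_le_one
  refine ⟨fun z => ?_, fun z z' => ?_, fun p hp z => ?_⟩
  · exact ((fderiv ℝ f z).le_of_opNorm_le (hn z) _).trans (by rw [one_mul]; exact hb.norm_le z)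
  · have e : fderiv ℝ f z (b z) - fderiv ℝ f z' (b z')
        = (fderiv ℝ f z - fderiv ℝ f z') (b z) + fderiv ℝ f z' (b z - b z') := by
      simp
    rw [e]
    refine (norm_add_le _ _).trans ?_
    have h1 : ‖(fderiv ℝ f z - fderiv ℝ f z') (b z)‖ ≤ (A * ‖z - z'‖) * B' :=
      ((fderiv ℝ f z - fderiv ℝ f z').le_of_opNorm_le (hf.lip_fderiv z z') _).trans
        (mul_le_mul_of_nonneg_left (hb.norm_le z) (by positivity))
    have h2 : ‖fderiv ℝ f z' (b z - b z')‖ ≤ L' * ‖z - z'‖ :=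
      ((fderiv ℝ f z').le_of_opNorm_le (hn z') _).trans (by rw [one_mul]; exact hb.lip z z')
    linarith
  · simp only [hf.fderiv_periodic p hp, hb.periodic p hp]

/-- Weak solutions of `∂ₜ m + div (field b k m · m) = 0` that are carried by the fixed compact
set `K`. -/
structure IsWeakSol (Λ : Set V) (b : V → V) (k : V → V → V) (K : Set V) (T : ℝ)
    (m : ℝ → Measure V) : Prop where
  finite : ∀ t ∈ Icc 0 T, IsFiniteMeasure (m t)
  carried : ∀ t ∈ Icc 0 T, m t Kᶜ = 0
  cont : ∀ (B L : ℝ) (f : V → ℝ), IsBL Λ B L f →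
    ContinuousOn (fun t => ∫ z, f z ∂(m t)) (Icc 0 T)
  eqn : ∀ (B L A : ℝ) (f : V → ℝ), IsC11 Λ B L A f → ∀ t ∈ Ico 0 T,
    ∫ z, f z ∂(m t) - ∫ z, f z ∂(m 0) =
      ∫ s in (0 : ℝ)..t, ∫ z, fderiv ℝ f z (field b k (m s) z) ∂(m s)

variable {K : Set V} {T M : ℝ} {m n : ℝ → Measure V}

/-- The weak equation is available only for `t < T`; the endpoint is reached by continuity. -/
theorem le_on_Icc_of_le_on_Ico {f : ℝ → ℝ} {c : ℝ} (hT : 0 < T) (hf : ContinuousOn f (Icc 0 T))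
    (h : ∀ t ∈ Ico 0 T, f t ≤ c) : ∀ t ∈ Icc 0 T, f t ≤ c := by
  intro t ht
  rcases ht.2.lt_or_eq with h' | rfl
  · exact h t ⟨ht.1, h'⟩
  · have h1 : Tendsto f (𝓝[Ico 0 t] t) (𝓝 (f t)) := (hf t ht).mono_left
      (nhdsWithin_mono _ Ico_subset_Icc_self)
    have : (𝓝[Ico 0 t] t).NeBot := by
      rw [← mem_closure_iff_nhdsWithin_neBot, closure_Ico hT.ne]
      exact ht
    exact le_of_tendsto h1 (eventually_mem_nhdsWithin.mono h)

/-- Testing with the constant `1` shows that mass is conserved. -/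
theorem IsWeakSol.mass_le (hm : IsWeakSol Λ b k K T m) (hT : 0 < T)
    (h0 : (m 0).real univ ≤ M) : ∀ t ∈ Icc 0 T, (m t).real univ ≤ M := by
  have h1 : IsC11 Λ 1 0 0 (fun _ : V => (1 : ℝ)) :=
    ⟨⟨by simp, by simp, by simp⟩, by fun_prop, by simp⟩
  refine le_on_Icc_of_le_on_Ico hT (f := fun t => (m t).real univ) ?_ fun t ht => ?_
  · simpa using hm.cont _ _ _ h1.toIsBL
  · have := hm.eqn _ _ _ _ h1 t ht
    simp [sub_eq_zero] at this
    rwa [this]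

/-- Weak continuity for a family of integrands that depends continuously on time. -/
theorem IsWeakSol.continuousOn_integral (hm : IsWeakSol Λ b k K T m) (hK : IsCompact K)
    (hL : 0 ≤ L) (hM : ∀ t ∈ Icc 0 T, (m t).real univ ≤ M) {u : ℝ → V → ℝ}
    (hu : ∀ t ∈ Icc 0 T, IsBL Λ B L (u t)) (hc : ∀ z, ContinuousOn (fun t => u t z) (Icc 0 T)) :
    ContinuousOn (fun t => ∫ z, u t z ∂(m t)) (Icc 0 T) := by
  intro t ht
  have hM0 : 0 ≤ M := measureReal_nonneg.trans (hM t ht)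
  have h1 : Tendsto (fun s => ∫ z, u t z ∂(m s)) (𝓝[Icc 0 T] t) (𝓝 (∫ z, u t z ∂(m t))) :=
    hm.cont _ _ _ (hu t ht) t ht
  have h2 : Tendsto (fun s => ∫ z, u s z ∂(m s) - ∫ z, u t z ∂(m s)) (𝓝[Icc 0 T] t) (𝓝 0) := by
    rw [Metric.tendsto_nhds]
    intro ε hε
    -- Pointwise convergence on a finite `η`-net of `K` and the common Lipschitz constant give the
    -- uniform bound `(2L + 1)η` on `K`; integration then costs at most `ε / 2`.
    set η : ℝ := ε / (2 * (2 * L + 1) * (M + 1)) with hη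
    have hη0 : 0 < η := by positivity
    obtain ⟨F, -, hF, hcov⟩ := hK.finite_cover_balls hη0
    have h3 : ∀ᶠ s in 𝓝[Icc 0 T] t, ∀ z ∈ F, |u s z - u t z| < η := by
      refine (hF.eventually_all).2 fun z _ => ?_
      have := Metric.tendsto_nhds.1 (hc z t ht) η hη0
      simpa [Real.dist_eq] using this
    filter_upwards [h3, eventually_mem_nhdsWithin] with s hs hsT
    have := hm.finite s hsT
    rw [dist_zero_right, ← integral_sub ((hu s hsT).integrable _) ((hu t ht).integrable _)]
    have hb : ∀ᵐ z ∂(m s), ‖u s z - u t z‖ ≤ (2 * L + 1) * η := by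
      have : ∀ᵐ z ∂(m s), z ∈ K := hm.carried s hsT
      filter_upwards [this] with z hz
      obtain ⟨y, hy, hzy⟩ := mem_iUnion₂.1 (hcov hz)
      have hzy' : ‖z - y‖ ≤ η := by rw [← dist_eq_norm]; exact (Metric.mem_ball.1 hzy).le
      have e1 := ((hu s hsT).lip z y).trans (mul_le_mul_of_nonneg_left hzy' hL)
      have e2 := ((hu t ht).lip z y).trans (mul_le_mul_of_nonneg_left hzy' hL)
      have e3 := hs y hy
      rw [Real.norm_eq_abs, abs_le] at *
      rw [abs_lt] at e3
      constructor <;> linarith [e1.1, e1.2, e2.1, e2.2, e3.1, e3.2]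
    calc _ ≤ (2 * L + 1) * η * (m s).real univ := norm_integral_le_of_norm_le_const hb
      _ ≤ (2 * L + 1) * η * (M + 1) := by
        gcongr
        linarith [hM s hsT]
      _ = ε / 2 := by rw [hη]; field_simp
      _ < ε := by linarith
  have := h2.add h1
  simp only [sub_add_cancel, zero_add] at this
  exact this

end Stability

/-! ### Time increments and the Euler step -/

section Increments

variable {V : Type*} [NormedAddCommGroup V] [NormedSpace ℝ V]
variable [FiniteDimensional ℝ V] [MeasurableSpace V] [BorelSpace V]
variable {Λ : Set V} {B L : ℝ} {b : V → V} {k : V → V → V}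
variable {K : Set V} {T M : ℝ} {m n : ℝ → Measure V}

/-- Supplies the integrability in time needed to subtract the weak equation at two times. For fixed
`z` the integrand is continuous in time because the field is an integral of a bounded Lipschitz
kernel. -/
theorem IsWeakSol.continuousOn_rhs (hm : IsWeakSol Λ b k K T m) (hk : IsKernel Λ B L b k)
    (hK : IsCompact K) (hM : ∀ t ∈ Icc 0 T, (m t).real univ ≤ M) {B₀ A : ℝ} (hA : 0 ≤ A)
    {f : V → ℝ} (hf : IsC11 Λ B₀ 1 A f) :
    ContinuousOn (fun t => ∫ z, fderiv ℝ f z (field b k (m t) z) ∂(m t)) (Icc 0 T) := by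
  rcases (Icc (0 : ℝ) T).eq_empty_or_nonempty with he | ⟨t₀, ht₀⟩
  · rw [he]; exact continuousOn_empty _
  have hM0 : 0 ≤ M := measureReal_nonneg.trans (hM t₀ ht₀)
  have hB := hk.drift.bound_nonneg
  have hL := hk.nonneg
  refine hm.continuousOn_integral hK (B := B * (1 + M)) (L := A * (B * (1 + M)) + L * (1 + M))
    (by positivity) hM (fun t ht => ?_) fun z => ?_
  · have := hm.finite t ht
    exact hf.apply_isBL hA (hk.field_isBL (hM t ht))
  · have h1 : IsBL Λ B L fun w => fderiv ℝ f z (k z w) := by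
      have := hk.right z
      have hn := hf.norm_fderiv_le zero_le_one z
      refine ⟨fun w => ?_, fun w w' => ?_, fun p hp w => by rw [this.periodic p hp]⟩
      · exact ((fderiv ℝ f z).le_of_opNorm_le hn _).trans
          (by rw [one_mul]; exact this.norm_le w)
      · rw [← map_sub]
        exact ((fderiv ℝ f z).le_of_opNorm_le hn _).trans
          (by rw [one_mul]; exact this.lip w w')
    refine (continuousOn_const.add (hm.cont _ _ _ h1) :
      ContinuousOn (fun t => fderiv ℝ f z (b z) + ∫ w, fderiv ℝ f z (k z w) ∂(m t)) _).congr
      fun t ht => ?_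
    have := hm.finite t ht
    change fderiv ℝ f z (field b k (m t) z)
      = fderiv ℝ f z (b z) + ∫ w, fderiv ℝ f z (k z w) ∂(m t)
    rw [field, map_add, (fderiv ℝ f z).integral_comp_comm ((hk.right z).integrable _)]

theorem IsWeakSol.sub_eq_integral (hm : IsWeakSol Λ b k K T m) (hk : IsKernel Λ B L b k)
    (hK : IsCompact K) (hM : ∀ t ∈ Icc 0 T, (m t).real univ ≤ M) {B₀ A : ℝ} (hA : 0 ≤ A)
    {f : V → ℝ} (hf : IsC11 Λ B₀ 1 A f) {s t : ℝ} (ht : 0 ≤ t) (hts : t ≤ s) (hs : s < T) :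
    IntervalIntegrable (fun r => ∫ z, fderiv ℝ f z (field b k (m r) z) ∂(m r)) volume t s ∧
    ∫ z, f z ∂(m s) - ∫ z, f z ∂(m t) =
      ∫ r in t..s, ∫ z, fderiv ℝ f z (field b k (m r) z) ∂(m r) := by
  have hc := hm.continuousOn_rhs hk hK hM hA hf
  have hi : ∀ x y, 0 ≤ x → x ≤ y → y < T → IntervalIntegrable
      (fun r => ∫ z, fderiv ℝ f z (field b k (m r) z) ∂(m r)) volume x y := fun x y hx hxy hy =>
    (hc.mono (Icc_subset_Icc hx hy.le)).intervalIntegrable_of_Icc hxy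
  refine ⟨hi t s ht hts hs, ?_⟩
  have h1 := hm.eqn _ _ _ _ hf s ⟨ht.trans hts, hs⟩
  have h2 := hm.eqn _ _ _ _ hf t ⟨ht, hts.trans_lt hs⟩
  have h3 := intervalIntegral.integral_add_adjacent_intervals
    (hi 0 t le_rfl ht (hts.trans_lt hs)) (hi t s ht hts hs)
  linarith

/-- A 1-Lipschitz function changes along the field at speed at most `B(1 + M)`, and the mass is at
most `M`. The bound does not see `A`. -/
theorem IsWeakSol.abs_sub_le (hm : IsWeakSol Λ b k K T m) (hk : IsKernel Λ B L b k)
    (hK : IsCompact K) (hM : ∀ t ∈ Icc 0 T, (m t).real univ ≤ M) {B₀ A : ℝ} (hA : 0 ≤ A)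
    {f : V → ℝ} (hf : IsC11 Λ B₀ 1 A f) {s t : ℝ} (ht : 0 ≤ t) (hts : t ≤ s) (hs : s < T) :
    |∫ z, f z ∂(m s) - ∫ z, f z ∂(m t)| ≤ B * (1 + M) * M * (s - t) := by
  rw [(hm.sub_eq_integral hk hK hM hA hf ht hts hs).2, ← Real.norm_eq_abs,
    ← abs_of_nonneg (sub_nonneg.2 hts)]
  refine intervalIntegral.norm_integral_le_of_norm_le_const fun r hr => ?_
  rw [uIoc_of_le hts] at hr
  have hrT : r ∈ Icc 0 T := ⟨ht.trans hr.1.le, hr.2.trans hs.le⟩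
  have := hm.finite r hrT
  have h1 := hf.apply_isBL hA (hk.field_isBL (hM r hrT))
  exact (norm_integral_le_of_norm_le_const (Eventually.of_forall h1.norm_le)).trans
    (mul_le_mul_of_nonneg_left (hM r hrT) h1.bound_nonneg)

/-- The standard bump function with radius `ε`. -/
noncomputable def bump (V : Type*) [NormedAddCommGroup V] (ε : ℝ) (hε : 0 < ε) :
    ContDiffBump (0 : V) :=
  ⟨ε / 2, ε, by positivity, by linarith⟩

/-- Mollification at radius `ε` moves a 1-Lipschitz function by at most `ε`, so passing from smooth
tests to all bounded Lipschitz tests costs `ε` times the total masses. -/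
theorem abs_integral_sub_le_of_mollified {m n : Measure V} [IsFiniteMeasure m]
    [IsFiniteMeasure n] {A ε D : ℝ} (hε : 0 < ε) (hA : mollConst (bump V ε hε) ≤ A)
    (hD : ∀ f : V → ℝ, IsC11 Λ 1 1 A f → |∫ z, f z ∂m - ∫ z, f z ∂n| ≤ D) :
    BLBound Λ m n (D + (m.real univ + n.real univ) * ε) := by
  intro h hh
  obtain ⟨g, hg, hgh⟩ := hh.mollify zero_le_one (bump V ε hε)
  rw [one_mul] at hg
  have hg' : ∀ z, ‖g z - h z‖ ≤ ε := fun z => (hgh z).trans_eq (by rw [one_mul]; rfl)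
  have h1 := hD g (hg.mono le_rfl le_rfl hA)
  have h2 : ∀ p : Measure V, IsFiniteMeasure p →
      |∫ z, g z ∂p - ∫ z, h z ∂p| ≤ ε * p.real univ := by
    intro p _
    rw [← integral_sub (hg.toIsBL.integrable p) (hh.integrable p)]
    exact norm_integral_le_of_norm_le_const (Eventually.of_forall hg')
  have h3 := h2 m inferInstance
  have h4 := h2 n inferInstance
  rw [abs_le] at *
  constructor <;> linarith [h1.1, h1.2, h3.1, h3.2, h4.1, h4.2]

/-- Since `IsWeakSol.abs_sub_le` is uniform in `A`, the mollification radius can be sent to zero. -/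
theorem IsWeakSol.blBound (hm : IsWeakSol Λ b k K T m) (hk : IsKernel Λ B L b k)
    (hK : IsCompact K) (hM : ∀ t ∈ Icc 0 T, (m t).real univ ≤ M) {s t : ℝ}
    (ht : 0 ≤ t) (hts : t ≤ s) (hs : s < T) :
    BLBound Λ (m s) (m t) (B * (1 + M) * M * (s - t)) := by
  intro h hh
  have hsT : s ∈ Icc 0 T := ⟨ht.trans hts, hs.le⟩
  have htT : t ∈ Icc 0 T := ⟨ht, hts.trans hs.le⟩
  have := hm.finite s hsT
  have := hm.finite t htT
  have hM0 : 0 ≤ M := measureReal_nonneg.trans (hM t htT)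
  refine le_of_forall_pos_le_add fun η hη => ?_
  have hε : 0 < η / (2 * M + 1) := by positivity
  refine (abs_integral_sub_le_of_mollified hε le_rfl
    (fun f hf => hm.abs_sub_le hk hK hM (mollConst_nonneg _) hf ht hts hs) h hh).trans ?_
  gcongr
  rw [mul_div_assoc', div_le_iff₀ (by positivity), mul_comm]
  exact mul_le_mul_of_nonneg_left (by linarith [hM s hsT, hM t htT]) hη.le

/-- Second order expansion in time of the integral of a test function. -/
theorem IsWeakSol.abs_sub_sub_le (hm : IsWeakSol Λ b k K T m) (hk : IsKernel Λ B L b k)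
    (hK : IsCompact K) (hM : ∀ t ∈ Icc 0 T, (m t).real univ ≤ M) {B₀ A : ℝ} (hA : 0 ≤ A)
    {f : V → ℝ} (hf : IsC11 Λ B₀ 1 A f) {s t : ℝ} (ht : 0 ≤ t) (hts : t ≤ s) (hs : s < T) :
    |∫ z, f z ∂(m s) - ∫ z, f z ∂(m t)
        - (s - t) * ∫ z, fderiv ℝ f z (field b k (m t) z) ∂(m t)| ≤
      ((B + L) * M + (B * (1 + M) + (A * (B * (1 + M)) + L * (1 + M)))) *
        (B * (1 + M) * M) * (s - t) ^ 2 := by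
  obtain ⟨hi, he⟩ := hm.sub_eq_integral hk hK hM hA hf ht hts hs
  have htT : t ∈ Icc 0 T := ⟨ht, hts.trans hs.le⟩
  have := hm.finite t htT
  have hM0 : 0 ≤ M := measureReal_nonneg.trans (hM t htT)
  have hB := hk.drift.bound_nonneg
  have hL := hk.nonneg
  set c := ∫ z, fderiv ℝ f z (field b k (m t) z) ∂(m t) with hc
  have hconst : (s - t) * c = ∫ r in t..s, c := by
    rw [intervalIntegral.integral_const, smul_eq_mul]
  rw [he, hconst, ← intervalIntegral.integral_sub hi intervalIntegrable_const,
    ← Real.norm_eq_abs, pow_two, ← mul_assoc]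
  nth_rewrite 2 [← abs_of_nonneg (sub_nonneg.2 hts)]
  refine intervalIntegral.norm_integral_le_of_norm_le_const fun r hr => ?_
  rw [uIoc_of_le hts] at hr
  have hrT : r ∈ Icc 0 T := ⟨ht.trans hr.1.le, hr.2.trans hs.le⟩
  have := hm.finite r hrT
  have hD := hm.blBound hk hK hM ht hr.1.le (hr.2.trans_lt hs)
  have h1 := hf.apply_isBL hA (hk.field_isBL (hM t htT))
  have h2 := hf.apply_isBL hA (hk.field_isBL (hM r hrT))
  -- Between times `t` and `r` the integrand changes through the field (`e1`) and through the
  -- measure (`e2`); `IsWeakSol.blBound` makes both `O(r - t)`.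
  have e1 : ‖∫ z, fderiv ℝ f z (field b k (m r) z) ∂(m r)
      - ∫ z, fderiv ℝ f z (field b k (m t) z) ∂(m r)‖
      ≤ (B + L) * (B * (1 + M) * M * (r - t)) * M := by
    rw [← integral_sub (h2.integrable _) (h1.integrable _)]
    have hpos : 0 ≤ (B + L) * (B * (1 + M) * M * (r - t)) := by
      have := sub_nonneg.2 hr.1.le
      positivity
    refine (norm_integral_le_of_norm_le_const (C := (B + L) * (B * (1 + M) * M * (r - t)))
      (Eventually.of_forall fun z => ?_)).trans (mul_le_mul_of_nonneg_left (hM r hrT) hpos)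
    rw [← map_sub]
    refine ((fderiv ℝ f z).le_of_opNorm_le (hf.norm_fderiv_le zero_le_one z) _).trans ?_
    rw [one_mul]
    exact hk.norm_field_sub_le hD z
  have e2 := hD.apply h1 (by positivity)
  calc _ ≤ (B + L) * (B * (1 + M) * M * (r - t)) * M +
        (B * (1 + M) + (A * (B * (1 + M)) + L * (1 + M))) * (B * (1 + M) * M * (r - t)) := by
        refine le_trans ?_ (add_le_add e1 e2)
        refine le_trans (le_of_eq ?_) (norm_add_le _ _)
        congr 1
        rw [hc]
        ring
    _ = ((B + L) * M + (B * (1 + M) + (A * (B * (1 + M)) + L * (1 + M)))) *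
        (B * (1 + M) * M) * (r - t) := by ring
    _ ≤ _ := by
        gcongr
        exact hr.2

/-- Composition of a test function with an Euler step. -/
theorem IsC11.comp_euler {A β l δ : ℝ} {f : V → ℝ} {c : V → V} (hf : IsC11 Λ 1 1 A f)
    (hc : IsC11 Λ β l (l * A) c) (hA : 0 ≤ A) (hl : 0 ≤ l) (hδ : 0 ≤ δ) :
    IsC11 Λ 1 (1 + δ * l) (A * ((1 + δ * l) ^ 2 + δ * l)) (fun z => f (z + δ • c z)) := by
  have hlip : ∀ z z', ‖(z + δ • c z) - (z' + δ • c z')‖ ≤ (1 + δ * l) * ‖z - z'‖ := by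
    intro z z'
    have e : (z + δ • c z) - (z' + δ • c z') = (z - z') + δ • (c z - c z') := by
      rw [smul_sub]; abel
    rw [e]
    refine (norm_add_le _ _).trans ?_
    rw [norm_smul, Real.norm_of_nonneg hδ, add_mul, one_mul, mul_assoc]
    gcongr
    exact hc.lip z z'
  have hd : ∀ z, HasFDerivAt (fun z => z + δ • c z)
      (ContinuousLinearMap.id ℝ V + δ • fderiv ℝ c z) z := fun z =>
    (hasFDerivAt_id z).add ((hc.differentiable z).hasFDerivAt.const_smul δ)
  have hF : ∀ z, HasFDerivAt (fun z => f (z + δ • c z))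
      ((fderiv ℝ f (z + δ • c z)).comp (ContinuousLinearMap.id ℝ V + δ • fderiv ℝ c z)) z :=
    fun z => (hf.differentiable _).hasFDerivAt.comp z (hd z)
  refine ⟨⟨fun z => hf.norm_le _, fun z z' => ?_, fun p hp z => ?_⟩,
    fun z => (hF z).differentiableAt, fun z z' => ?_⟩
  · exact (hf.lip _ _).trans (by rw [one_mul]; exact hlip z z')
  · rw [hc.periodic p hp, add_right_comm, hf.periodic p hp]
  · rw [(hF z).fderiv, (hF z').fderiv]
    set P := ContinuousLinearMap.id ℝ V + δ • fderiv ℝ c z with hP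
    set Q := ContinuousLinearMap.id ℝ V + δ • fderiv ℝ c z' with hQ
    -- Either `Df` or the Jacobian of the Euler map varies. Both variations are proportional to `A`,
    -- because the derivative of `c` is `l * A`-Lipschitz; hence `A` is only multiplied by a factor
    -- close to one.
    have e : (fderiv ℝ f (z + δ • c z)).comp P - (fderiv ℝ f (z' + δ • c z')).comp Q
        = (fderiv ℝ f (z + δ • c z) - fderiv ℝ f (z' + δ • c z')).comp P
          + (fderiv ℝ f (z' + δ • c z')).comp (P - Q) := by
      ext x; simp
    have hPn : ‖P‖ ≤ 1 + δ * l := by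
      refine (norm_add_le _ _).trans ?_
      rw [norm_smul, Real.norm_of_nonneg hδ]
      gcongr
      · exact ContinuousLinearMap.norm_id_le
      · exact hc.norm_fderiv_le hl z
    have hPQ : ‖P - Q‖ ≤ δ * (l * A * ‖z - z'‖) := by
      rw [hP, hQ, add_sub_add_left_eq_sub, ← smul_sub, norm_smul, Real.norm_of_nonneg hδ]
      gcongr
      exact hc.lip_fderiv z z'
    rw [e]
    calc _ ≤ (A * ((1 + δ * l) * ‖z - z'‖)) * (1 + δ * l) + 1 * (δ * (l * A * ‖z - z'‖)) := by
          refine (norm_add_le _ _).trans (add_le_add ?_ ?_)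
          · refine (ContinuousLinearMap.opNorm_comp_le _ _).trans ?_
            gcongr
            refine (hf.lip_fderiv _ _).trans ?_
            gcongr
            exact hlip z z'
          · refine (ContinuousLinearMap.opNorm_comp_le _ _).trans ?_
            gcongr
            exact hf.norm_fderiv_le zero_le_one _
      _ = _ := by ring

/-- Growth over a short time of the distance tested on functions with `A`-Lipschitz derivative. -/
theorem IsWeakSol.abs_integral_sub_le_step (hm : IsWeakSol Λ b k K T m)
    (hn : IsWeakSol Λ b k K T n) (hk : IsKernel Λ B L b k) (hK : IsCompact K)
    (hMm : ∀ t ∈ Icc 0 T, (m t).real univ ≤ M) (hMn : ∀ t ∈ Icc 0 T, (n t).real univ ≤ M)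
    {A ε D : ℝ} (hε : 0 < ε) (hA : mollConst (bump V ε hε) ≤ A) {s t : ℝ} (ht : 0 ≤ t)
    (hts : t ≤ s) (hs : s < T) (hst : s - t ≤ 1)
    (hD : ∀ f : V → ℝ, IsC11 Λ 1 1 A f → |∫ z, f z ∂(m t) - ∫ z, f z ∂(n t)| ≤ D)
    {f : V → ℝ} (hf : IsC11 Λ 1 1 A f) :
    |∫ z, f z ∂(m s) - ∫ z, f z ∂(n s)| ≤ D
      + (s - t) * ((3 * (L * (1 + M)) + (L * (1 + M)) ^ 2 + (B + L) * M) * D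
        + (2 * M * (L * (1 + M)) + 2 * M ^ 2 * (B + L)) * ε)
      + 2 * (((B + L) * M + (B * (1 + M) + (A * (B * (1 + M)) + L * (1 + M)))) *
        (B * (1 + M) * M) + M * (A * (B * (1 + M)) ^ 2)) * (s - t) ^ 2 := by
  have hA0 : 0 ≤ A := (mollConst_nonneg _).trans hA
  have htT : t ∈ Icc 0 T := ⟨ht, hts.trans hs.le⟩
  have := hm.finite t htT
  have := hn.finite t htT
  have hM0 : 0 ≤ M := measureReal_nonneg.trans (hMm t htT)
  have hB := hk.drift.bound_nonneg
  have hL := hk.nonneg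
  have em := hm.abs_sub_sub_le hk hK hMm hA0 hf ht hts hs
  have en := hn.abs_sub_sub_le hk hK hMn hA0 hf ht hts hs
  have hbm := hk.field_isBL (hMm t htT)
  have hbn := hk.field_isBL (hMn t htT)
  set Q := ((B + L) * M + (B * (1 + M) + (A * (B * (1 + M)) + L * (1 + M)))) *
        (B * (1 + M) * M) with hQ
  set l := L * (1 + M) with hl
  set β := B * (1 + M) with hβ
  set δ := s - t with hδ
  have hl0 : 0 ≤ l := by positivity
  have hβ0 : 0 ≤ β := by positivity
  have hδ0 : 0 ≤ δ := sub_nonneg.2 hts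
  have hD0 : 0 ≤ D := (abs_nonneg _).trans (hD f hf)
  -- The bump is the one that defines the threshold for `A`, as `comp_euler` requires. Only the
  -- field of `m` is used, so both measures meet the same Euler map.
  obtain ⟨c, hc, hcb⟩ := hbm.mollify hl0 (bump V ε hε)
  replace hc : IsC11 Λ β l (l * A) c := hc.mono le_rfl le_rfl (mul_le_mul_of_nonneg_left hA hl0)
  replace hcb : ∀ z, ‖c z - field b k (m t) z‖ ≤ l * ε := hcb
  have hF := hf.comp_euler hc hA0 hl0 hδ0
  -- the composed function, rescaled into the class
  set κ := 1 + (3 * l + l ^ 2) * δ with hκ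
  have hκ0 : 0 < κ := by positivity
  -- Step length at most one makes `(1 + δl)² + δl ≤ κ`, which is the worst of the three growth
  -- factors.
  have hδ2 : δ ^ 2 ≤ δ := by nlinarith
  have hF1 : IsC11 Λ 1 1 A (fun z => κ⁻¹ • f (z + δ • c z)) := by
    refine (hF.const_smul κ⁻¹).mono ?_ ?_ ?_ <;>
      rw [abs_of_pos (inv_pos.2 hκ0), inv_mul_le_iff₀ hκ0]
    · rw [hκ, mul_one]
      have : 0 ≤ (3 * l + l ^ 2) * δ := by positivity
      linarith
    · rw [hκ]
      have : 0 ≤ (2 * l + l ^ 2) * δ := by positivity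
      linarith
    · rw [mul_comm κ A]
      gcongr
      have : l ^ 2 * δ ^ 2 ≤ l ^ 2 * δ := by gcongr
      rw [hκ]
      linarith
  have hFD : |∫ z, f (z + δ • c z) ∂(m t) - ∫ z, f (z + δ • c z) ∂(n t)| ≤ κ * D := by
    have := hD _ hF1
    rw [integral_smul, integral_smul, ← smul_sub, smul_eq_mul, abs_mul,
      abs_of_pos (inv_pos.2 hκ0), inv_mul_le_iff₀ hκ0] at this
    exact this
  -- one explicit Euler step
  have hg := hf.apply_isBL hA0 hbm
  -- The first error is the Taylor remainder, the second the replacement of the field by its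
  -- mollification.
  have hstep : ∀ z, ‖f (z + δ • c z) - (f z + δ * fderiv ℝ f z (field b k (m t) z))‖
      ≤ A * β ^ 2 * δ ^ 2 + δ * (l * ε) := by
    intro z
    have e : f (z + δ • c z) - (f z + δ * fderiv ℝ f z (field b k (m t) z))
        = (f (z + δ • c z) - f z - fderiv ℝ f z (δ • c z))
          + δ * fderiv ℝ f z (c z - field b k (m t) z) := by
      simp only [map_sub, map_smul, smul_eq_mul]; ring
    rw [e]
    refine (norm_add_le _ _).trans (add_le_add ?_ ?_)
    · refine (hf.taylor hA0 z _).trans ?_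
      rw [norm_smul, Real.norm_of_nonneg hδ0, mul_assoc, mul_pow, mul_comm (δ ^ 2)]
      gcongr
      exact hc.norm_le z
    · rw [norm_mul, Real.norm_of_nonneg hδ0]
      gcongr
      refine ((fderiv ℝ f z).le_of_opNorm_le (hf.norm_fderiv_le zero_le_one z) _).trans ?_
      rw [one_mul]
      exact hcb z
  have hI : ∀ p : Measure V, IsFiniteMeasure p → p.real univ ≤ M →
      |∫ z, f (z + δ • c z) ∂p - (∫ z, f z ∂p
        + δ * ∫ z, fderiv ℝ f z (field b k (m t) z) ∂p)|
        ≤ (A * β ^ 2 * δ ^ 2 + δ * (l * ε)) * M := by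
    intro p _ hp
    have hsum : Integrable (fun z => f z + δ * fderiv ℝ f z (field b k (m t) z)) p :=
      (hf.toIsBL.integrable p).add ((hg.integrable p).const_mul δ)
    rw [← integral_const_mul, ← integral_add (hf.toIsBL.integrable p)
      ((hg.integrable p).const_mul δ), ← integral_sub (hF.toIsBL.integrable p) hsum]
    exact (norm_integral_le_of_norm_le_const (Eventually.of_forall hstep)).trans
      (mul_le_mul_of_nonneg_left hp (by positivity))
  have hIm := hI (m t) inferInstance (hMm t htT)
  have hIn := hI (n t) inferInstance (hMn t htT)
  -- comparison of the two fields
  have hBL : BLBound Λ (m t) (n t) (D + 2 * M * ε) := fun h hh =>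
    (abs_integral_sub_le_of_mollified hε hA hD h hh).trans (by
      gcongr
      linarith [hMm t htT, hMn t htT])
  -- The expansion of `n` contains its own field; replacing it by the field of `m` costs a multiple
  -- of the distance being estimated.
  have hfield : |∫ z, fderiv ℝ f z (field b k (m t) z) ∂(n t)
      - ∫ z, fderiv ℝ f z (field b k (n t) z) ∂(n t)|
      ≤ (B + L) * (D + 2 * M * ε) * M := by
    rw [← integral_sub (hg.integrable _) ((hf.apply_isBL hA0 hbn).integrable _),
      ← Real.norm_eq_abs]
    have hpos : 0 ≤ (B + L) * (D + 2 * M * ε) := by positivity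
    refine (norm_integral_le_of_norm_le_const (C := (B + L) * (D + 2 * M * ε))
      (Eventually.of_forall fun z => ?_)).trans (mul_le_mul_of_nonneg_left (hMn t htT) hpos)
    rw [← map_sub]
    refine ((fderiv ℝ f z).le_of_opNorm_le (hf.norm_fderiv_le zero_le_one z) _).trans ?_
    rw [one_mul]
    exact hk.norm_field_sub_le hBL z
  have hfield' : |δ * ∫ z, fderiv ℝ f z (field b k (m t) z) ∂(n t)
      - δ * ∫ z, fderiv ℝ f z (field b k (n t) z) ∂(n t)|
      ≤ δ * ((B + L) * (D + 2 * M * ε) * M) := by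
    rw [← mul_sub, abs_mul, abs_of_nonneg hδ0]
    gcongr
  rw [hκ] at hFD
  rw [abs_le] at em en hFD hIm hIn hfield' ⊢
  constructor <;>
    linarith [em.1, em.2, en.1, en.2, hFD.1, hFD.2, hIm.1, hIm.2, hIn.1, hIn.2,
      hfield'.1, hfield'.2]

end Increments

/-! ### Gronwall argument and removal of the mollification -/

section Gronwall

variable {V : Type*} [NormedAddCommGroup V] [NormedSpace ℝ V]
variable [FiniteDimensional ℝ V] [MeasurableSpace V] [BorelSpace V]
variable {Λ : Set V} {B L : ℝ} {b : V → V} {k : V → V → V}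
variable {K : Set V} {T M : ℝ} {m n : ℝ → Measure V}

/-- The distance of two measures tested on functions with `A`-Lipschitz derivative. -/
noncomputable def testDist (Λ : Set V) (A : ℝ) (m n : Measure V) : ℝ :=
  ⨆ f : {f : V → ℝ // IsC11 Λ 1 1 A f}, |∫ z, f.1 z ∂m - ∫ z, f.1 z ∂n|

theorem testDist_le {A D : ℝ} (hA : 0 ≤ A) {m n : Measure V}
    (h : ∀ f : V → ℝ, IsC11 Λ 1 1 A f → |∫ z, f z ∂m - ∫ z, f z ∂n| ≤ D) :
    testDist Λ A m n ≤ D := by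
  have : Nonempty {f : V → ℝ // IsC11 Λ 1 1 A f} :=
    ⟨⟨fun _ => 0, ⟨⟨by simp, by simp, by simp⟩, by fun_prop, by simp; intros; positivity⟩⟩⟩
  exact ciSup_le fun f => h f.1 f.2

theorem le_testDist {A : ℝ} (m n : Measure V) [IsFiniteMeasure m] [IsFiniteMeasure n]
    {f : V → ℝ} (hf : IsC11 Λ 1 1 A f) :
    |∫ z, f z ∂m - ∫ z, f z ∂n| ≤ testDist Λ A m n := by
  refine le_ciSup (f := fun f : {f : V → ℝ // IsC11 Λ 1 1 A f} =>
    |∫ z, f.1 z ∂m - ∫ z, f.1 z ∂n|) ⟨1 * m.real univ + 1 * n.real univ, ?_⟩ ⟨f, hf⟩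
  rintro _ ⟨g, rfl⟩
  refine (abs_sub _ _).trans (add_le_add ?_ ?_) <;>
  exact norm_integral_le_of_norm_le_const (Eventually.of_forall g.2.norm_le)

/-- Each tested difference is Lipschitz in time with a constant independent of the test function, so
the supremum is Lipschitz too. -/
theorem IsWeakSol.continuousOn_testDist (hm : IsWeakSol Λ b k K T m)
    (hn : IsWeakSol Λ b k K T n) (hk : IsKernel Λ B L b k) (hK : IsCompact K)
    (hMm : ∀ t ∈ Icc 0 T, (m t).real univ ≤ M) (hMn : ∀ t ∈ Icc 0 T, (n t).real univ ≤ M)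
    {A : ℝ} (hA : 0 ≤ A) : ContinuousOn (fun t => testDist Λ A (m t) (n t)) (Ico 0 T) := by
  set C := 2 * (B * (1 + M) * M) with hC
  have key : ∀ s ∈ Ico 0 T, ∀ t ∈ Ico 0 T, testDist Λ A (m s) (n s)
      ≤ testDist Λ A (m t) (n t) + C * |s - t| := by
    intro s hs t ht
    have hb : ∀ p : ℝ → Measure V, IsWeakSol Λ b k K T p →
        (∀ t ∈ Icc 0 T, (p t).real univ ≤ M) → ∀ f : V → ℝ, IsC11 Λ 1 1 A f →
        |∫ z, f z ∂(p s) - ∫ z, f z ∂(p t)| ≤ B * (1 + M) * M * |s - t| := by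
      intro p hp hMp f hf
      rcases le_total t s with h | h
      · rw [abs_of_nonneg (sub_nonneg.2 h)]
        exact hp.abs_sub_le hk hK hMp hA hf ht.1 h hs.2
      · rw [abs_sub_comm, abs_sub_comm s, abs_of_nonneg (sub_nonneg.2 h)]
        exact hp.abs_sub_le hk hK hMp hA hf hs.1 h ht.2
    refine testDist_le hA fun f hf => ?_
    have := hm.finite t ⟨ht.1, ht.2.le⟩
    have := hn.finite t ⟨ht.1, ht.2.le⟩
    have h1 := hb m hm hMm f hf
    have h2 := hb n hn hMn f hf
    have h3 := le_testDist (m t) (n t) hf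
    rw [abs_le] at h1 h2 h3 ⊢
    constructor <;> linarith [h1.1, h1.2, h2.1, h2.2, h3.1, h3.2]
  refine LipschitzOnWith.continuousOn (K := C.toNNReal)
    (LipschitzOnWith.of_dist_le_mul fun s hs t ht => ?_)
  have h1 := key s hs t ht
  have h2 := key t ht s hs
  rw [abs_sub_comm] at h2
  rw [Real.dist_eq, Real.dist_eq]
  refine le_trans ?_ (mul_le_mul_of_nonneg_right (Real.le_coe_toNNReal C) (abs_nonneg _))
  rw [abs_le]
  constructor <;> linarith

/-- Stability of weak solutions in the bounded Lipschitz distance. -/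
theorem IsWeakSol.stability (hm : IsWeakSol Λ b k K T m)
    (hn : IsWeakSol Λ b k K T n) (hk : IsKernel Λ B L b k) (hK : IsCompact K) (hT : 0 < T)
    (hMm : (m 0).real univ ≤ M) (hMn : (n 0).real univ ≤ M)
    {D : ℝ} (hD : BLBound Λ (m 0) (n 0) D) {t : ℝ} (ht : t ∈ Icc 0 T) :
    BLBound Λ (m t) (n t) (D * Real.exp
      ((3 * (L * (1 + M)) + (L * (1 + M)) ^ 2 + (B + L) * M) * T)) := by
  replace hMm := hm.mass_le hT hMm
  replace hMn := hn.mass_le hT hMn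
  have h0T : (0 : ℝ) ∈ Icc 0 T := ⟨le_rfl, hT.le⟩
  have hM0 : 0 ≤ M := measureReal_nonneg.trans (hMm 0 h0T)
  have hB := hk.drift.bound_nonneg
  have hL := hk.nonneg
  set C := 3 * (L * (1 + M)) + (L * (1 + M)) ^ 2 + (B + L) * M with hC
  have hC0 : 0 ≤ C := by positivity
  have hD0 : 0 ≤ D := (abs_nonneg _).trans
    (hD (fun _ => 0) ⟨by simp, by simp, by simp⟩)
  intro h hh
  refine le_on_Icc_of_le_on_Ico hT
    (f := fun t => |∫ z, h z ∂(m t) - ∫ z, h z ∂(n t)|)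
    ((hm.cont _ _ _ hh).sub (hn.cont _ _ _ hh)).abs (fun t ht => ?_) t ht
  clear * - hm hn hk hK hT hMm hMn hD hM0 hB hL hC0 hD0 hh ht
  set C' := 2 * M * (L * (1 + M)) + 2 * M ^ 2 * (B + L) with hC'
  have htT : t ∈ Icc 0 T := ⟨ht.1, ht.2.le⟩
  have key : ∀ ε > 0, |∫ z, h z ∂(m t) - ∫ z, h z ∂(n t)|
      ≤ gronwallBound D C (C' * ε) t + 2 * M * ε := by
    intro ε hε
    set A := mollConst (bump V ε hε) with hA
    have hA0 : 0 ≤ A := mollConst_nonneg _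
    set φ : ℝ → ℝ := fun t => testDist Λ A (m t) (n t) with hφ
    have hg : ∀ x ∈ Icc 0 t, φ x ≤ gronwallBound D C (C' * ε) (x - 0) := by
      -- The supremum need not be differentiable; a bound on right difference quotients suffices.
      refine le_gronwallBound_of_liminf_deriv_right_le (f' := fun x => C * φ x + C' * ε)
        ((hm.continuousOn_testDist hn hk hK hMm hMn hA0).mono
          fun x hx => ⟨hx.1, hx.2.trans_lt ht.2⟩) (fun x hx r hr => ?_)
        (testDist_le hA0 fun f hf => hD f hf.toIsBL) fun x hx => le_rfl
      have hxT : x < T := hx.2.trans ht.2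
      have hxI : x ∈ Icc 0 T := ⟨hx.1, hxT.le⟩
      have := hm.finite x hxI
      have := hn.finite x hxI
      set Q := 2 * (((B + L) * M + (B * (1 + M) + (A * (B * (1 + M)) + L * (1 + M)))) *
        (B * (1 + M) * M) + M * (A * (B * (1 + M)) ^ 2)) with hQ
      -- `Q` contains `A` and may blow up as `ε → 0`, but here `ε` is fixed and the term disappears
      -- as `z → x`.
      have hlim : Tendsto (fun z => C * φ x + C' * ε + Q * (z - x)) (𝓝[>] x)
          (𝓝 (C * φ x + C' * ε + Q * (x - x))) :=
        ((by fun_prop : Continuous fun z => C * φ x + C' * ε + Q * (z - x)).tendsto x).mono_left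
          nhdsWithin_le_nhds
      rw [sub_self, mul_zero, add_zero] at hlim
      refine Eventually.frequently ?_
      filter_upwards [hlim.eventually_lt_const hr, self_mem_nhdsWithin,
        mem_nhdsWithin_of_mem_nhds (Iio_mem_nhds (lt_min hxT (lt_add_one x)))] with z hz hxz hzT
      replace hzT : z < min T (x + 1) := hzT
      replace hxz : 0 < z - x := sub_pos.2 hxz
      refine lt_of_le_of_lt ?_ hz
      rw [inv_mul_le_iff₀ hxz]
      have := testDist_le hA0 fun f hf => hm.abs_integral_sub_le_step hn hk hK hMm hMn hε le_rfl
        hx.1 (sub_pos.1 hxz).le (hzT.trans_le (min_le_left _ _))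
        (by linarith [hzT.trans_le (min_le_right _ _)])
        (fun f hf => le_testDist (m x) (n x) hf) hf
      change φ z ≤ φ x + (z - x) * (C * φ x + C' * ε) + Q * (z - x) ^ 2 at this
      linarith
    have := hm.finite t htT
    have := hn.finite t htT
    have h1 := abs_integral_sub_le_of_mollified hε le_rfl
      (fun f hf => le_testDist (m t) (n t) hf) h hh
    have h2 := hg t ⟨ht.1, le_rfl⟩
    rw [sub_zero] at h2
    refine h1.trans (add_le_add h2 ?_)
    gcongr
    linarith [hMm t htT, hMn t htT]
  -- Neither `C` nor `C'` depends on `A`, so `ε` can now be sent to zero.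
  have hcont : Continuous fun ε => gronwallBound D C (C' * ε) t + 2 * M * ε :=
    ((gronwallBound_continuous_ε D C t).comp (continuous_const_mul C')).add
      (continuous_const_mul _)
  have hlim := (hcont.tendsto 0).mono_left (nhdsWithin_le_nhds (s := Ioi 0))
  simp only [mul_zero, add_zero, gronwallBound_ε0] at hlim
  refine (ge_of_tendsto hlim (eventually_mem_nhdsWithin.mono key)).trans ?_
  gcongr
  exact ht.2.le

end Gronwall

/-! ### Calculus of bounded Lipschitz functions with unspecified constants -/

section BoundedLipschitz

variable {U V W W' : Type*} [NormedAddCommGroup U] [NormedSpace ℝ U] [NormedAddCommGroup V]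
  [NormedSpace ℝ V] [NormedAddCommGroup W] [NormedSpace ℝ W] [NormedAddCommGroup W']
  [NormedSpace ℝ W'] {Λ : Set V} {f g : V → W}

/-- Bounded Lipschitz functions invariant under the translations in `Λ`. -/
def BddLip (Λ : Set V) (f : V → W) : Prop := ∃ B L : ℝ, 0 ≤ L ∧ IsBL Λ B L f

theorem bddLip_const (c : W) : BddLip Λ (fun _ => c) :=
  ⟨‖c‖, 0, le_rfl, fun _ => le_rfl, by simp, by simp⟩

theorem BddLip.sub (hf : BddLip Λ f) (hg : BddLip Λ g) : BddLip Λ (fun x => f x - g x) := by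
  obtain ⟨B, L, hL, hf⟩ := hf
  obtain ⟨B', L', hL', hg⟩ := hg
  have := hf.add (hg.const_smul (-1))
  refine ⟨_, _, ?_, by simpa [← sub_eq_add_neg] using this⟩
  positivity

theorem BddLip.smul {a : V → ℝ} (ha : BddLip Λ a) (hf : BddLip Λ f) :
    BddLip Λ (fun x => a x • f x) := by
  obtain ⟨B, L, hL, ha⟩ := ha
  obtain ⟨B', L', hL', hf⟩ := hf
  have hB := ha.bound_nonneg
  have hB' := hf.bound_nonneg
  refine ⟨B * B', L * B' + B * L', by positivity, fun x => ?_, fun x y => ?_, fun p hp x => ?_⟩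
  · rw [norm_smul]
    gcongr
    · exact ha.norm_le x
    · exact hf.norm_le x
  · have e : a x • f x - a y • f y = (a x - a y) • f x + a y • (f x - f y) := by
      rw [sub_smul, smul_sub]; abel
    rw [e]
    calc _ ≤ (L * ‖x - y‖) * B' + B * (L' * ‖x - y‖) := by
          refine (norm_add_le _ _).trans ?_
          rw [norm_smul, norm_smul]
          gcongr
          · exact ha.lip x y
          · exact hf.norm_le x
          · exact ha.norm_le y
          · exact hf.lip x y
      _ = _ := by ring
  · rw [ha.periodic p hp, hf.periodic p hp]

theorem BddLip.prodMk {h : V → W'} (hf : BddLip Λ f) (hh : BddLip Λ h) :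
    BddLip Λ (fun x => (f x, h x)) := by
  obtain ⟨B, L, hL, hf⟩ := hf
  obtain ⟨B', L', hL', hh⟩ := hh
  have hB := hf.bound_nonneg
  have hB' := hh.bound_nonneg
  refine ⟨B + B', L + L', by positivity, fun x => ?_, fun x y => ?_, fun p hp x => ?_⟩
  · exact norm_prod_le_iff.2 ⟨(hf.norm_le x).trans (by linarith),
      (hh.norm_le x).trans (by linarith)⟩
  · have := norm_nonneg (x - y)
    refine norm_prod_le_iff.2 ⟨(hf.lip x y).trans ?_, (hh.lip x y).trans ?_⟩ <;>
    · gcongr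
      linarith
  · rw [hf.periodic p hp, hh.periodic p hp]

theorem BddLip.comp_clm {Λ' : Set U} (hf : BddLip Λ f) (ℓ : U →L[ℝ] V)
    (hℓ : ∀ p ∈ Λ', ℓ p ∈ Λ) : BddLip Λ' (fun x => f (ℓ x)) := by
  obtain ⟨B, L, hL, hf⟩ := hf
  refine ⟨B, L * ‖ℓ‖, by positivity, fun x => hf.norm_le _, fun x y => ?_, fun p hp x => ?_⟩
  · refine (hf.lip _ _).trans ?_
    rw [← map_sub, mul_assoc]
    gcongr
    exact ℓ.le_opNorm _
  · rw [map_add, hf.periodic _ (hℓ p hp)]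

/-- Joint regularity gives separate regularity; because zero is a period, one variable can be
shifted while the other stays fixed. -/
theorem BddLip.isKernel {b : V → V} {k : V × V → V} (h0 : (0 : V) ∈ Λ) (hb : BddLip Λ b)
    (hk : BddLip (Λ ×ˢ Λ) k) : ∃ B L, IsKernel Λ B L b (fun z w => k (z, w)) := by
  obtain ⟨B, L, hL, hb⟩ := hb
  obtain ⟨B', L', hL', hk⟩ := hk
  have hB := hb.bound_nonneg
  have hB' := hk.bound_nonneg
  refine ⟨B + B', L + L', by positivity, hb.mono (by linarith) (by linarith), fun w => ?_,
    fun z => ?_⟩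
  · refine IsBL.mono (B := B') (L := L') ⟨fun z => hk.norm_le _, fun z z' => ?_,
      fun p hp z => ?_⟩ (by linarith) (by linarith)
    · refine (hk.lip _ _).trans (mul_le_mul_of_nonneg_left ?_ hL')
      simp [Prod.norm_def]
    · simpa using hk.periodic (p, 0) ⟨hp, h0⟩ (z, w)
  · refine IsBL.mono (B := B') (L := L') ⟨fun w => hk.norm_le _, fun w w' => ?_,
      fun p hp w => ?_⟩ (by linarith) (by linarith)
    · refine (hk.lip _ _).trans (mul_le_mul_of_nonneg_left ?_ hL')
      simp [Prod.norm_def]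
    · simpa using hk.periodic (0, p) ⟨h0, hp⟩ (z, w)

end BoundedLipschitz

/-! ### The universal cover and a measurable section -/

section Cover

variable {d : ℕ}

/-- The universal cover of the phase space, with all real temperatures. -/
abbrev Cover (d : ℕ) : Type :=
  EuclideanSpace ℝ (Fin d) × EuclideanSpace ℝ (Fin d) × ℝ

/-- The deck transformations of the torus. -/
def torusPeriods (d : ℕ) : Set (EuclideanSpace ℝ (Fin d)) := {p | toTorus p = 0}

/-- The deck transformations of the phase space. -/
def periods (d : ℕ) : Set (Cover d) := {p | toTorus p.1 = 0 ∧ p.2 = 0}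

theorem toTorus_add (y y' : EuclideanSpace ℝ (Fin d)) :
    toTorus (y + y') = toTorus y + toTorus y' := by
  ext i; simp [toTorus]

theorem toTorus_sub (y y' : EuclideanSpace ℝ (Fin d)) :
    toTorus (y - y') = toTorus y - toTorus y' := by
  ext i; simp [toTorus]

theorem toTorus_zero : toTorus (0 : EuclideanSpace ℝ (Fin d)) = 0 := by
  ext i; simp [toTorus]

theorem norm_coe_unitAddCircle_le (r : ℝ) : ‖(r : UnitAddCircle)‖ ≤ |r| := by
  rw [UnitAddCircle.norm_eq]
  simpa using round_le r 0

/-- A measurable section of the covering map. -/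
noncomputable def torusSec (x : UnitAddTorus (Fin d)) : EuclideanSpace ℝ (Fin d) :=
  WithLp.toLp 2 fun i => (AddCircle.measurableEquivIoc (1 : ℝ) 0 (x i) : ℝ)

theorem toTorus_torusSec (x : UnitAddTorus (Fin d)) : toTorus (torusSec x) = x := by
  ext i
  exact (AddCircle.measurableEquivIoc (1 : ℝ) 0).symm_apply_apply (x i)

theorem measurable_torusSec : Measurable (torusSec (d := d)) := by
  unfold torusSec
  refine (WithLp.measurable_toLp 2 _).comp (measurable_pi_lambda _ fun i => ?_)
  exact measurable_subtype_coe.comp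
    ((AddCircle.measurableEquivIoc (1 : ℝ) 0).measurable.comp (measurable_pi_apply i))

theorem norm_torusSec_le (x : UnitAddTorus (Fin d)) : ‖torusSec x‖ ≤ Real.sqrt d := by
  rw [EuclideanSpace.norm_eq]
  refine Real.sqrt_le_sqrt ?_
  calc _ ≤ ∑ _i : Fin d, (1 : ℝ) := by
        refine Finset.sum_le_sum fun i _ => ?_
        have h := (AddCircle.measurableEquivIoc (1 : ℝ) 0 (x i)).2
        rw [Real.norm_eq_abs, sq_abs]
        exact pow_le_one₀ h.1.le (h.2.trans_eq (zero_add 1))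
    _ = d := by simp

/-- The measurable section of the projection of the cover onto the phase space. -/
noncomputable def lift (z : Phase d) : Cover d := (torusSec z.1, z.2.1, (z.2.2 : ℝ))

theorem measurable_lift : Measurable (lift (d := d)) :=
  (measurable_torusSec.comp measurable_fst).prodMk
    ((measurable_fst.comp measurable_snd).prodMk
      (measurable_subtype_coe.comp (measurable_snd.comp measurable_snd)))

theorem eq_of_toTorus_eq {W : Type*} {f : Cover d → W}
    (hf : ∀ p ∈ periods d, ∀ x, f (x + p) = f x) {y y' : EuclideanSpace ℝ (Fin d)}
    (h : toTorus y = toTorus y') (q : EuclideanSpace ℝ (Fin d) × ℝ) : f (y, q) = f (y', q) := by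
  have := hf (y - y', 0) ⟨by rw [toTorus_sub, h, sub_self], rfl⟩ (y', q)
  simpa using this

/-- Displacements on the torus lift to displacements of the same length. -/
theorem exists_toTorus_eq (x : UnitAddTorus (Fin d)) :
    ∃ y : EuclideanSpace ℝ (Fin d), toTorus y = x ∧ ‖y‖ ^ 2 = ∑ i, ‖x i‖ ^ 2 := by
  -- Subtracting the nearest integer leaves a coordinate whose absolute value is the circle norm.
  refine ⟨WithLp.toLp 2 fun i => torusSec x i - round (torusSec x i), ?_, ?_⟩
  · conv_rhs => rw [← toTorus_torusSec x]
    ext i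
    simp only [toTorus, AddCircle.coe_sub, sub_eq_self]
    rw [AddCircle.coe_eq_zero_iff]
    exact ⟨round (torusSec x i), by simp⟩
  · rw [EuclideanSpace.norm_sq_eq]
    refine Finset.sum_congr rfl fun i _ => ?_
    conv_rhs => rw [← toTorus_torusSec x]
    simp only [toTorus]
    rw [UnitAddCircle.norm_eq, Real.norm_eq_abs]

/-- The section jumps, but periodicity allows a representative of `z` nearest to the lift of `z'`.
The product sup norm on the cover is at most the Euclidean distance, so no constant is lost. -/
theorem abs_lift_sub_le {B L : ℝ} {f : Cover d → ℝ} (hf : IsBL (periods d) B L f) (hL : 0 ≤ L)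
    (z z' : Phase d) : |f (lift z) - f (lift z')| ≤ L * phaseDist z z' := by
  obtain ⟨y, hy, hn⟩ := exists_toTorus_eq (z.1 - z'.1)
  have h1 : f (lift z) = f (torusSec z'.1 + y, z.2.1, (z.2.2 : ℝ)) :=
    eq_of_toTorus_eq hf.periodic (by
      rw [toTorus_add, hy, toTorus_torusSec, toTorus_torusSec]; abel) _
  rw [h1]
  refine (hf.lip _ _).trans (mul_le_mul_of_nonneg_left ?_ hL)
  simp only [lift, Prod.mk_sub_mk, add_sub_cancel_left]
  have hS : (0 : ℝ) ≤ ∑ i, ‖(z.1 - z'.1) i‖ ^ 2 := by positivity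
  have e : phaseDist z z' = Real.sqrt (‖y‖ ^ 2 + ‖z.2.1 - z'.2.1‖ ^ 2
    + ((z.2.2 : ℝ) - (z'.2.2 : ℝ)) ^ 2) := by rw [hn]; rfl
  rw [e]
  refine norm_prod_le_iff.2 ⟨?_, norm_prod_le_iff.2 ⟨?_, ?_⟩⟩ <;> apply Real.le_sqrt_of_sq_le
  · nlinarith [sq_nonneg ‖z.2.1 - z'.2.1‖, sq_nonneg ((z.2.2 : ℝ) - (z'.2.2 : ℝ))]
  · nlinarith [sq_nonneg ‖y‖, sq_nonneg ((z.2.2 : ℝ) - (z'.2.2 : ℝ))]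
  · simp only [Real.norm_eq_abs, sq_abs]
    nlinarith [sq_nonneg ‖z.2.1 - z'.2.1‖, sq_nonneg ‖y‖]

theorem continuous_comp_lift {B L : ℝ} {f : Cover d → ℝ} (hf : IsBL (periods d) B L f)
    (hL : 0 ≤ L) : Continuous fun z => f (lift z) := by
  refine continuous_iff_continuousAt.2 fun z => ?_
  refine tendsto_iff_dist_tendsto_zero.2 (squeeze_zero (fun _ => dist_nonneg)
    (fun z' => abs_lift_sub_le hf hL z' z) ?_)
  have hc : Continuous fun z' => L * phaseDist z' z := by
    unfold phaseDist
    fun_prop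
  have := hc.tendsto z
  simpa [phaseDist] using this

/-- Boundedness comes from compactness of the torus; the covering map does not increase distances.
-/
theorem BddLip.comp_toTorus {φ : UnitAddTorus (Fin d) → ℝ} {K : ℝ≥0} (hφ : LipschitzWith K φ) :
    BddLip (torusPeriods d) (fun y => φ (toTorus y)) := by
  obtain ⟨B, hB⟩ := isCompact_univ.exists_bound_of_continuousOn hφ.continuous.continuousOn
  refine ⟨B, K, K.2, fun y => hB _ (mem_univ _), fun y y' => ?_, fun p hp y => ?_⟩
  · rw [← dist_eq_norm]
    refine (hφ.dist_le_mul _ _).trans (mul_le_mul_of_nonneg_left ?_ K.2)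
    refine (dist_pi_le_iff (norm_nonneg _)).2 fun i => ?_
    rw [dist_eq_norm]
    change ‖((y i : ℝ) : UnitAddCircle) - ((y' i : ℝ) : UnitAddCircle)‖ ≤ _
    rw [← AddCircle.coe_sub]
    exact (norm_coe_unitAddCircle_le _).trans (PiLp.norm_apply_le (y - y') i)
  · rw [toTorus_add, show toTorus p = 0 from hp, add_zero]

end Cover

/-! ### Truncation of the drift and of the interaction -/

section Cutoffs

variable {d : ℕ} {P θm θM : ℝ}

/-- Cutoff in the velocity, equal to `1` near the ball of radius `P`. -/
noncomputable def velCut (d : ℕ) (hP : 0 < P) : ContDiffBump (0 : EuclideanSpace ℝ (Fin d)) :=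
  ⟨2 * P, 3 * P, by linarith, by linarith⟩

/-- Cutoff in the temperature, equal to `1` near `[θm, θM]` and supported in `(0, ∞)`. -/
noncomputable def tempCut (θM : ℝ) (hθm : 0 < θm) : ContDiffBump ((θm + max θm θM) / 2) :=
  -- The outer interval starts at `θm / 2`, away from zero. The maximum keeps the radii positive
  -- even if `θM < θm`.
  ⟨(max θm θM - θm) / 2 + θm / 4, (max θm θM - θm) / 2 + θm / 2,
    by linarith [le_max_left θm θM], by linarith⟩

theorem velCut_eventually_eq (hP : 0 < P) {v : EuclideanSpace ℝ (Fin d)}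
    (hv : v ∈ Metric.closedBall 0 P) : ∀ᶠ w in 𝓝 v, velCut d hP w = 1 := by
  refine (velCut d hP).eventuallyEq_one_of_mem_ball ?_
  rw [Metric.mem_ball]
  exact (Metric.mem_closedBall.1 hv).trans_lt (show P < 2 * P by linarith)

theorem tempCut_eventually_eq (hθm : 0 < θm) {θ : ℝ} (hθ : θ ∈ Icc θm θM) :
    ∀ᶠ r in 𝓝 θ, tempCut θM hθm r = 1 := by
  refine (tempCut θM hθm).eventuallyEq_one_of_mem_ball ?_
  rw [Metric.mem_ball, Real.dist_eq, abs_lt]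
  change -((max θm θM - θm) / 2 + θm / 4) < _ ∧ _ < (max θm θM - θm) / 2 + θm / 4
  have := le_max_right θm θM
  constructor <;> linarith [hθ.1, hθ.2]

theorem tempCut_eq_zero (hθm : 0 < θm) {θ : ℝ} (hθ : θ ∉ Icc (θm / 2) (max θm θM + θm)) :
    tempCut θM hθm θ = 0 := by
  refine (tempCut θM hθm).zero_of_le_dist ?_
  rw [Real.dist_eq]
  change (max θm θM - θm) / 2 + θm / 2 ≤ _
  by_contra! h
  rw [abs_lt] at h
  exact hθ ⟨by linarith [h.1], by linarith [h.2]⟩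

theorem velCut_eq_zero (hP : 0 < P) {v : EuclideanSpace ℝ (Fin d)}
    (hv : v ∉ Metric.closedBall 0 (3 * P)) : velCut d hP v = 0 := by
  refine (velCut d hP).zero_of_le_dist ?_
  rw [Metric.mem_closedBall, not_le] at hv
  exact hv.le

theorem isCompact_phase_box {R a c : ℝ} (ha : 0 < a) : IsCompact (box d R a c) := by
  have h1 : IsCompact {θ : Ioi (0 : ℝ) | (θ : ℝ) ∈ Icc a c} := by
    rw [Subtype.isCompact_iff]
    convert isCompact_Icc (a := a) (b := c) using 1
    ext θ
    constructor
    · rintro ⟨θ', h, rfl⟩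
      exact h
    · intro h
      exact ⟨⟨θ, ha.trans_le h.1⟩, h, rfl⟩
  have h2 := (isCompact_univ (X := UnitAddTorus (Fin d))).prod
    ((isCompact_closedBall (0 : EuclideanSpace ℝ (Fin d)) R).prod h1)
  convert h2 using 1
  ext z
  simp [box]

/-- The truncated drift. -/
noncomputable def drift (d : ℕ) (hP : 0 < P) (z : Cover d) : Cover d :=
  (velCut d hP z.2.1 • z.2.1, 0, 0)

/-- The truncated interaction kernel. -/
noncomputable def kern (φ ζ : UnitAddTorus (Fin d) → ℝ) (hP : 0 < P) (θm : ℝ)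
    (q : Cover d × Cover d) : Cover d :=
  (0, φ (toTorus (q.1.1 - q.2.1)) • ((max q.2.2.2 θm)⁻¹ • (velCut d hP q.2.2.1 • q.2.2.1)
      - (max q.1.2.2 θm)⁻¹ • (velCut d hP q.1.2.1 • q.1.2.1)),
    ζ (toTorus (q.1.1 - q.2.1)) • ((max q.1.2.2 θm)⁻¹ - (max q.2.2.2 θm)⁻¹))

/-- A compactly supported `C¹` map is bounded and Lipschitz. With the period set `{0}` invariance is
vacuous, and composing with a linear map that kills the periods restores it. -/
theorem bddLip_vel (hP : 0 < P) :
    BddLip {0} (fun v : EuclideanSpace ℝ (Fin d) => velCut d hP v • v) := by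
  have hc : ContDiff ℝ 1 (fun v : EuclideanSpace ℝ (Fin d) => velCut d hP v • v) :=
    (velCut d hP).contDiff.smul contDiff_id
  have hs : HasCompactSupport (fun v : EuclideanSpace ℝ (Fin d) => velCut d hP v • v) :=
    (velCut d hP).hasCompactSupport.smul_right
  obtain ⟨B, hB⟩ := hs.exists_bound_of_continuous hc.continuous
  obtain ⟨L, hL⟩ := ContDiff.lipschitzWith_of_hasCompactSupport hs hc one_ne_zero
  refine ⟨B, L, L.2, hB, fun v w => ?_, fun p hp v => ?_⟩
  · rw [← dist_eq_norm, ← dist_eq_norm]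
    exact hL.dist_le_mul v w
  · rw [mem_singleton_iff.1 hp, add_zero]

theorem bddLip_temp (hθm : 0 < θm) : BddLip {0} (fun θ : ℝ => (max θ θm)⁻¹) := by
  have hm : ∀ θ, θm ≤ max θ θm := fun θ => le_max_right _ _
  refine ⟨θm⁻¹, (θm * θm)⁻¹, by positivity, fun θ => ?_, fun a c => ?_, fun p hp v => ?_⟩
  · have := hθm.trans_le (hm θ)
    rw [Real.norm_of_nonneg (by positivity)]
    exact inv_anti₀ hθm (hm θ)
  · have h1 := hθm.trans_le (hm a)
    have h2 := hθm.trans_le (hm c)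
    rw [inv_sub_inv h1.ne' h2.ne', norm_div, div_eq_inv_mul,
      Real.norm_of_nonneg (mul_pos h1 h2).le]
    refine mul_le_mul (inv_anti₀ (by positivity)
      (mul_le_mul (hm a) (hm c) hθm.le h1.le)) ?_ (norm_nonneg _) (by positivity)
    rw [norm_sub_rev a c]
    exact abs_max_sub_max_le_abs c a θm
  · rw [mem_singleton_iff.1 hp, add_zero]

/-- The truncations make every factor bounded and Lipschitz. The position difference sends pairs of
deck transformations to torus periods, hence biperiodicity. -/
theorem exists_isKernel {φ ζ : UnitAddTorus (Fin d) → ℝ} (hφ : ∃ K : ℝ≥0, LipschitzWith K φ)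
    (hζ : ∃ K : ℝ≥0, LipschitzWith K ζ) (hP : 0 < P) (hθm : 0 < θm) :
    ∃ B L, IsKernel (periods d) B L (drift d hP) (fun z w => kern φ ζ hP θm (z, w)) := by
  obtain ⟨Kφ, hφ⟩ := hφ
  obtain ⟨Kζ, hζ⟩ := hζ
  have h0 : (0 : Cover d) ∈ periods d := ⟨toTorus_zero, rfl⟩
  let pv : Cover d →L[ℝ] EuclideanSpace ℝ (Fin d) :=
    (ContinuousLinearMap.fst ℝ _ _).comp (ContinuousLinearMap.snd ℝ _ _)
  let pt : Cover d →L[ℝ] ℝ :=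
    (ContinuousLinearMap.snd ℝ _ _).comp (ContinuousLinearMap.snd ℝ _ _)
  let p₁ : Cover d × Cover d →L[ℝ] Cover d := ContinuousLinearMap.fst ℝ _ _
  let p₂ : Cover d × Cover d →L[ℝ] Cover d := ContinuousLinearMap.snd ℝ _ _
  let px : Cover d × Cover d →L[ℝ] EuclideanSpace ℝ (Fin d) :=
    (ContinuousLinearMap.fst ℝ _ _).comp (p₁ - p₂)
  have hpx : ∀ p ∈ periods d ×ˢ periods d, px p ∈ torusPeriods d := by
    rintro ⟨p, q⟩ ⟨hp, hq⟩
    change toTorus (p.1 - q.1) = 0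
    rw [toTorus_sub, hp.1, hq.1, sub_self]
  have hv : BddLip (periods d) (fun z : Cover d => velCut d hP z.2.1 • z.2.1) :=
    (bddLip_vel hP).comp_clm pv fun p hp => by
      rw [mem_singleton_iff]; change p.2.1 = 0; rw [hp.2]; rfl
  have ht : BddLip (periods d) (fun z : Cover d => (max z.2.2 θm)⁻¹) :=
    (bddLip_temp hθm).comp_clm pt fun p hp => by
      rw [mem_singleton_iff]; change p.2.2 = 0; rw [hp.2]; rfl
  have hvt := ht.smul hv
  refine BddLip.isKernel h0 (hv.prodMk (bddLip_const 0)) (k := kern φ ζ hP θm) ?_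
  refine (bddLip_const 0).prodMk (BddLip.prodMk ?_ ?_)
  · exact ((BddLip.comp_toTorus hφ).comp_clm px hpx).smul
      ((hvt.comp_clm p₂ fun p hp => hp.2).sub (hvt.comp_clm p₁ fun p hp => hp.1))
  · exact ((BddLip.comp_toTorus hζ).comp_clm px hpx).smul
      ((ht.comp_clm p₁ fun p hp => hp.1).sub (ht.comp_clm p₂ fun p hp => hp.2))

end Cutoffs

/-! ### From measure-valued solutions to weak solutions on the cover -/

section Translation

variable {d : ℕ} {P θm θM T : ℝ} {φ ζ : UnitAddTorus (Fin d) → ℝ}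

theorem measure_compl_box {μ : Measure (Phase d)} (h : μ.support ⊆ box d P θm θM) :
    μ (box d P θm θM)ᶜ = 0 :=
  measure_mono_null (compl_subset_compl.2 h) Measure.measure_compl_support

/-- Because `θm > 0`, the box is compact in the phase space, and a Radon measure is finite on it. -/
theorem isFiniteMeasure_of_support_subset {μ : Measure (Phase d)} [μ.Regular] (hθm : 0 < θm)
    (h : μ.support ⊆ box d P θm θM) : IsFiniteMeasure μ := by
  refine ⟨?_⟩
  rw [← union_compl_self (box d P θm θM)]
  refine (measure_union_le _ _).trans_lt ?_
  rw [measure_compl_box h, add_zero]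
  exact (isCompact_phase_box hθm).measure_lt_top

/-- On the box the truncated mean field is the phase space velocity of the equation. -/
theorem field_lift {B L : ℝ} (hP : 0 < P)
    (hk : IsKernel (periods d) B L (drift d hP) (fun z w => kern φ ζ hP θm (z, w)))
    {μ : Measure (Phase d)} [IsFiniteMeasure μ] (hμ : μ (box d P θm θM)ᶜ = 0) {z : Phase d}
    (hz : z ∈ box d P θm θM) :
    field (drift d hP) (fun z w => kern φ ζ hP θm (z, w)) (μ.map lift) (lift z)
      = (z.2.1, force φ μ z, heating ζ μ z) := by
  have hcut : ∀ w ∈ box d P θm θM, velCut d hP w.2.1 = 1 := fun w hw =>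
    (velCut_eventually_eq hP hw.1).self_of_nhds
  have hmax : ∀ w ∈ box d P θm θM, max (w.2.2 : ℝ) θm = w.2.2 := fun w hw => max_eq_left hw.2.1
  have hdrift : drift d hP (lift z) = (z.2.1, 0, 0) := by
    simp [drift, lift, hcut z hz]
  have hinteg : Integrable (fun w => kern φ ζ hP θm (lift z, lift w)) μ :=
    ((hk.right (lift z)).integrable (μ.map lift)).comp_measurable measurable_lift
  have hae : ∀ᵐ w ∂μ, kern φ ζ hP θm (lift z, lift w)
      = (0, φ (z.1 - w.1) • ((w.2.2 : ℝ)⁻¹ • w.2.1 - (z.2.2 : ℝ)⁻¹ • z.2.1),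
        ζ (z.1 - w.1) * ((z.2.2 : ℝ)⁻¹ - (w.2.2 : ℝ)⁻¹)) := by
    have : ∀ᵐ w ∂μ, w ∈ box d P θm θM := hμ
    filter_upwards [this] with w hw
    simp [kern, lift, hcut z hz, hcut w hw, hmax z hz, hmax w hw, toTorus_sub,
      toTorus_torusSec]
  have hmap : ∫ w, kern φ ζ hP θm (lift z, w) ∂(μ.map lift)
      = ∫ w, kern φ ζ hP θm (lift z, lift w) ∂μ :=
    integral_map measurable_lift.aemeasurable (hk.right _).continuous.aestronglyMeasurable
  have h2 : (∫ w, kern φ ζ hP θm (lift z, lift w) ∂μ) = (0, force φ μ z, heating ζ μ z) := by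
    refine Prod.ext ?_ (Prod.ext ?_ ?_)
    · rw [fst_integral hinteg]
      exact (integral_congr_ae (hae.mono fun w hw => by rw [hw])).trans (integral_zero _ _)
    · rw [snd_integral hinteg, fst_integral hinteg.snd]
      exact integral_congr_ae (hae.mono fun w hw => by simp only [hw])
    · rw [snd_integral hinteg, snd_integral hinteg.snd]
      exact integral_congr_ae (hae.mono fun w hw => by simp only [hw])
  rw [field, hdrift, hmap, h2]
  simp

/-- A function on the cover cut off in velocity and temperature. -/
noncomputable def cutoff (hP : 0 < P) (θM : ℝ) (hθm : 0 < θm) (f : Cover d → ℝ) (q : Cover d) :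
    ℝ :=
  velCut d hP q.2.1 * tempCut θM hθm q.2.2 * f q

theorem cutoff_eventuallyEq (hP : 0 < P) (hθm : 0 < θm) (f : Cover d → ℝ) {z : Phase d}
    (hz : z ∈ box d P θm θM) : cutoff hP θM hθm f =ᶠ[𝓝 (lift z)] f := by
  have hv : Tendsto (fun q : Cover d => q.2.1) (𝓝 (lift z)) (𝓝 z.2.1) :=
    (by fun_prop : Continuous fun q : Cover d => q.2.1).tendsto (lift z)
  have ht : Tendsto (fun q : Cover d => q.2.2) (𝓝 (lift z)) (𝓝 (z.2.2 : ℝ)) :=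
    (by fun_prop : Continuous fun q : Cover d => q.2.2).tendsto (lift z)
  filter_upwards [hv.eventually (velCut_eventually_eq hP hz.1),
    ht.eventually (tempCut_eventually_eq hθm hz.2)] with q h1 h2
  simp [cutoff, h1, h2]

theorem cutoff_lift (hP : 0 < P) (hθm : 0 < θm) (f : Cover d → ℝ) {z : Phase d}
    (hz : z ∈ box d P θm θM) : cutoff hP θM hθm f (lift z) = f (lift z) :=
  (cutoff_eventuallyEq hP hθm f hz).self_of_nhds

theorem cutoff_lift_eq_zero (hP : 0 < P) (hθm : 0 < θm) (f : Cover d → ℝ) {z : Phase d}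
    (hz : z ∉ box d (3 * P) (θm / 2) (max θm θM + θm)) : cutoff hP θM hθm f (lift z) = 0 := by
  rw [cutoff]
  by_cases h : z.2.1 ∈ Metric.closedBall (0 : EuclideanSpace ℝ (Fin d)) (3 * P)
  · rw [show tempCut θM hθm (lift z).2.2 = 0 from tempCut_eq_zero hθm fun h' => hz ⟨h, h'⟩]
    simp
  · rw [show velCut d hP (lift z).2.1 = 0 from velCut_eq_zero hP h]
    simp

theorem cutoff_periodic (hP : 0 < P) (hθm : 0 < θm) {f : Cover d → ℝ}
    (hf : ∀ p ∈ periods d, ∀ x, f (x + p) = f x) :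
    ∀ p ∈ periods d, ∀ x, cutoff hP θM hθm f (x + p) = cutoff hP θM hθm f x := by
  intro p hp x
  have h2 : (x + p).2 = x.2 := by rw [Prod.snd_add, hp.2, add_zero]
  simp only [cutoff, h2, hf p hp]

theorem contDiff_cutoff (hP : 0 < P) (hθm : 0 < θm) {f : Cover d → ℝ} (hf : ContDiff ℝ 1 f) :
    ContDiff ℝ 1 (cutoff hP θM hθm f) :=
  (((velCut d hP).contDiff.comp (contDiff_fst.comp contDiff_snd)).mul
    ((tempCut θM hθm).contDiff.comp (contDiff_snd.comp contDiff_snd))).mul hf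

theorem integral_cutoff_lift (hP : 0 < P) (hθm : 0 < θm) (f : Cover d → ℝ)
    {μ : Measure (Phase d)} (hμ : μ (box d P θm θM)ᶜ = 0) :
    ∫ z, cutoff hP θM hθm f (lift z) ∂μ = ∫ z, f (lift z) ∂μ := by
  have : ∀ᵐ w ∂μ, w ∈ box d P θm θM := hμ
  exact integral_congr_ae (this.mono fun z hz => cutoff_lift hP hθm f hz)

/-- Weak continuity is given only for functions vanishing at infinity; the cutoff supplies one with
the same integrals. -/
theorem IsMeasureValuedSolution.continuousOn_lift {μ : ℝ → Measure (Phase d)}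
    (hμ : IsMeasureValuedSolution φ ζ T μ) (hP : 0 < P) (hθm : 0 < θm)
    (hs : ∀ t ∈ Icc 0 T, (μ t).support ⊆ box d P θm θM) {B L : ℝ} {f : Cover d → ℝ}
    (hf : IsBL (periods d) B L f) :
    ContinuousOn (fun t => ∫ z, f (lift z) ∂(μ t)) (Icc 0 T) := by
  have hc : Continuous fun z : Phase d => cutoff hP θM hθm f (lift z) := by
    have h1 := continuous_comp_lift (hf.mono le_rfl (le_max_left L 0)) (le_max_right L 0)
    have h2 : Continuous fun z : Phase d => velCut d hP z.2.1 :=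
      (velCut d hP).continuous.comp (by fun_prop)
    have h3 : Continuous fun z : Phase d => tempCut θM hθm (z.2.2 : ℝ) :=
      (tempCut θM hθm).continuous.comp (by fun_prop)
    exact (h2.mul h3).mul h1
  have hcs : HasCompactSupport fun z : Phase d => cutoff hP θM hθm f (lift z) :=
    HasCompactSupport.intro (isCompact_phase_box (by positivity))
      fun z hz => cutoff_lift_eq_zero hP hθm f hz
  refine (hμ.weaklyContinuous ⟨⟨_, hc⟩, hcs.is_zero_at_infty⟩).congr fun t ht => ?_
  exact (integral_cutoff_lift hP hθm f (measure_compl_box (hs t ht))).symm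

/-- Cutoff in time, equal to `1` near `[0, t]` and supported in `(-∞, T)`. -/
noncomputable def timeCut {t : ℝ} (ht : t ∈ Ico 0 T) : ContDiffBump (t / 2) :=
  ⟨t / 2 + (T - t) / 3, t / 2 + (T - t) / 2, by linarith [ht.1, ht.2], by linarith [ht.2]⟩

theorem timeCut_eventually_eq {t : ℝ} (ht : t ∈ Ico 0 T) {s : ℝ} (hs : s ∈ Icc 0 t) :
    ∀ᶠ r in 𝓝 s, timeCut ht r = 1 := by
  refine (timeCut ht).eventuallyEq_one_of_mem_ball ?_
  rw [Metric.mem_ball, Real.dist_eq, abs_lt]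
  change -(t / 2 + (T - t) / 3) < _ ∧ _ < t / 2 + (T - t) / 3
  constructor <;> linarith [hs.1, hs.2, ht.2]

theorem timeCut_eq_zero {t : ℝ} (ht : t ∈ Ico 0 T) {s : ℝ}
    (hs : s ∉ Icc (-T) ((T + t) / 2)) : timeCut ht s = 0 := by
  refine (timeCut ht).zero_of_le_dist ?_
  rw [Real.dist_eq]
  change t / 2 + (T - t) / 2 ≤ _
  by_contra! h
  rw [abs_lt] at h
  exact hs ⟨by linarith [h.1, ht.1, ht.2], by linarith [h.2]⟩

/-- The test function on the phase space made from a function on the cover. -/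
noncomputable def testFun (hP : 0 < P) (θM : ℝ) (hθm : 0 < θm) {t : ℝ} (ht : t ∈ Ico 0 T)
    (f : Cover d → ℝ) (s : ℝ) (z : Phase d) : ℝ :=
  timeCut ht s * cutoff hP θM hθm f (lift z)

theorem isTest_testFun (hP : 0 < P) (hθm : 0 < θm) {t : ℝ} (ht : t ∈ Ico 0 T) {f : Cover d → ℝ}
    (hf : ContDiff ℝ 1 f) (hp : ∀ p ∈ periods d, ∀ x, f (x + p) = f x) :
    IsTest T (testFun hP θM hθm ht f) := by
  have hsub : Function.support (Function.uncurry (testFun hP θM hθm ht f)) ⊆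
      Icc (-T) ((T + t) / 2) ×ˢ box d (3 * P) (θm / 2) (max θm θM + θm) := by
    rintro ⟨s, z⟩ h
    refine ⟨by_contra fun hs => h ?_, by_contra fun hz => h ?_⟩
    · change timeCut ht s * _ = 0
      rw [timeCut_eq_zero ht hs, zero_mul]
    · change timeCut ht s * cutoff hP θM hθm f (lift z) = 0
      rw [cutoff_lift_eq_zero hP hθm f hz, mul_zero]
  have hK : IsCompact (Icc (-T) ((T + t) / 2) ×ˢ
      box d (3 * P) (θm / 2) (max θm θM + θm)) :=
    isCompact_Icc.prod (isCompact_phase_box (by positivity))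
  refine ⟨?_, HasCompactSupport.of_support_subset_isCompact hK hsub, ?_⟩
  · have h1 : ContDiff ℝ 1 fun q : ℝ × Cover d => timeCut ht q.1 * cutoff hP θM hθm f q.2 :=
      ((timeCut ht).contDiff.comp contDiff_fst).mul
        ((contDiff_cutoff hP hθm hf).comp contDiff_snd)
    refine h1.contDiffOn.congr fun q hq => ?_
    have hq' : 0 < q.2.2.2 := hq
    simp only [inCoords, hq', dif_pos, testFun]
    congr 1
    -- The section of a projected point differs from that point by a deck transformation, so the
    -- discontinuous section drops out in coordinates.
    exact eq_of_toTorus_eq (cutoff_periodic hP hθm hp) (toTorus_torusSec _) _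
  · refine (closure_minimal hsub hK.isClosed).trans ?_
    rintro ⟨s, z⟩ ⟨hs, -⟩
    have h1 : s ≤ (T + t) / 2 := hs.2
    have h2 : s < T := by linarith [ht.2]
    exact ⟨h2, mem_univ _⟩

/-- The generator of the equation applied to the test function. -/
theorem generator_testFun (hP : 0 < P) (hθm : 0 < θm) {t : ℝ} (ht : t ∈ Ico 0 T)
    {f : Cover d → ℝ} (hf : ContDiff ℝ 1 f) (hp : ∀ p ∈ periods d, ∀ x, f (x + p) = f x)
    {s : ℝ} (hs : s ∈ Icc 0 t) {z : Phase d} (hz : z ∈ box d P θm θM)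
    (u v : EuclideanSpace ℝ (Fin d)) (c : ℝ) :
    dTime (testFun hP θM hθm ht f) s z + inner ℝ u (gradPos (testFun hP θM hθm ht f) s z)
      + inner ℝ v (gradVel (testFun hP θM hθm ht f) s z)
      + c * dTemp (testFun hP θM hθm ht f) s z = fderiv ℝ f (lift z) (u, v, c) := by
  set G := cutoff hP θM hθm f with hG
  have hχ := timeCut_eventually_eq ht hs
  have hχs : timeCut ht s = 1 := hχ.self_of_nhds
  have hgs : ∀ z, testFun hP θM hθm ht f s z = G (lift z) := fun z => by
    rw [testFun, hχs, one_mul]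
  have hGd : HasFDerivAt G (fderiv ℝ f (lift z)) (lift z) :=
    ((hf.differentiable one_ne_zero (lift z)).hasFDerivAt).congr_of_eventuallyEq
      (cutoff_eventuallyEq hP hθm f hz)
  have hGp := cutoff_periodic (θM := θM) hP hθm hp
  have h1 : dTime (testFun hP θM hθm ht f) s z = 0 := by
    have : (fun r => testFun hP θM hθm ht f r z) =ᶠ[𝓝 s] fun _ => G (lift z) :=
      hχ.mono fun r hr => by simp only [testFun, hr, one_mul, hG]
    rw [dTime, this.deriv_eq, deriv_const]
  have h2 : inner ℝ u (gradPos (testFun hP θM hθm ht f) s z)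
      = fderiv ℝ f (lift z) (u, 0, 0) := by
    have e : (fun y : EuclideanSpace ℝ (Fin d) =>
        testFun hP θM hθm ht f s (z.1 + toTorus y, z.2))
        = fun y => G (torusSec z.1 + y, z.2.1, (z.2.2 : ℝ)) := by
      ext y
      rw [hgs]
      exact eq_of_toTorus_eq hGp (by
        rw [toTorus_torusSec, toTorus_add, toTorus_torusSec]) _
    have hi : HasFDerivAt (fun y : EuclideanSpace ℝ (Fin d) =>
        ((torusSec z.1 + y, z.2.1, (z.2.2 : ℝ)) : Cover d))
        ((ContinuousLinearMap.id ℝ _).prod 0) 0 :=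
      ((hasFDerivAt_id _).const_add _).prodMk (hasFDerivAt_const _ _)
    have hGd' : HasFDerivAt G (fderiv ℝ f (lift z))
        (torusSec z.1 + 0, z.2.1, (z.2.2 : ℝ)) := by rw [add_zero]; exact hGd
    have hcomp := hGd'.comp (0 : EuclideanSpace ℝ (Fin d)) hi
    rw [gradPos, e, real_inner_comm, inner_gradient_left]
    exact congrArg (fun ℓ => ℓ u) hcomp.fderiv
  have h3 : inner ℝ v (gradVel (testFun hP θM hθm ht f) s z)
      = fderiv ℝ f (lift z) (0, v, 0) := by
    have e : (fun w : EuclideanSpace ℝ (Fin d) =>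
        testFun hP θM hθm ht f s (z.1, w, z.2.2))
        = fun w => G (torusSec z.1, w, (z.2.2 : ℝ)) := by
      ext w
      rw [hgs]
      rfl
    have hi : HasFDerivAt (fun w : EuclideanSpace ℝ (Fin d) =>
        ((torusSec z.1, w, (z.2.2 : ℝ)) : Cover d))
        (ContinuousLinearMap.prod 0 ((ContinuousLinearMap.id ℝ _).prod 0)) z.2.1 :=
      (hasFDerivAt_const _ _).prodMk ((hasFDerivAt_id _).prodMk (hasFDerivAt_const _ _))
    have hcomp := HasFDerivAt.comp (g := G) z.2.1 hGd hi
    rw [gradVel, e, real_inner_comm, inner_gradient_left]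
    exact congrArg (fun ℓ => ℓ v) hcomp.fderiv
  have h4 : dTemp (testFun hP θM hθm ht f) s z = fderiv ℝ f (lift z) (0, 0, 1) := by
    have e : (fun r : ℝ => if h : 0 < r then
        testFun hP θM hθm ht f s (z.1, z.2.1, ⟨r, h⟩) else 0)
        =ᶠ[𝓝 (z.2.2 : ℝ)] fun r => G (torusSec z.1, z.2.1, r) := by
      filter_upwards [Ioi_mem_nhds z.2.2.2] with r hr
      rw [dif_pos (show 0 < r from hr), hgs]
      rfl
    have hi : HasDerivAt (fun r : ℝ => ((torusSec z.1, z.2.1, r) : Cover d))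
        (0, 0, 1) (z.2.2 : ℝ) :=
      (hasDerivAt_const _ _).prodMk ((hasDerivAt_const _ _).prodMk (hasDerivAt_id _))
    have hcomp := HasFDerivAt.comp_hasDerivAt (l := G) (z.2.2 : ℝ) hGd hi
    rw [dTemp, e.deriv_eq]
    exact hcomp.deriv
  rw [h1, h2, h3, h4, zero_add, ← smul_eq_mul c, ← map_smul, ← map_add, ← map_add]
  simp

/-- Cutoffs equal to one near the box and near `[0, t]` change neither the integrals nor the
generator there, so every periodic `C^{1,1}` function on the cover becomes admissible. The radius
`√d` bounds the section. -/
theorem IsMeasureValuedSolution.isWeakSol {μ : ℝ → Measure (Phase d)}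
    (hμ : IsMeasureValuedSolution φ ζ T μ) (hP : 0 < P) (hθm : 0 < θm)
    (hs : ∀ t ∈ Icc 0 T, (μ t).support ⊆ box d P θm θM) {B L : ℝ}
    (hk : IsKernel (periods d) B L (drift d hP) (fun z w => kern φ ζ hP θm (z, w))) :
    IsWeakSol (periods d) (drift d hP) (fun z w => kern φ ζ hP θm (z, w))
      (Metric.closedBall 0 (Real.sqrt d) ×ˢ Metric.closedBall 0 P ×ˢ Icc θm θM) T
      (fun t => (μ t).map lift) := by
  have hfin : ∀ t ∈ Icc 0 T, IsFiniteMeasure (μ t) := fun t ht =>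
    have := hμ.radon t ht
    isFiniteMeasure_of_support_subset hθm (hs t ht)
  have hmap : ∀ (t : ℝ) (f : Cover d → ℝ), Continuous f →
      ∫ q, f q ∂((μ t).map lift) = ∫ z, f (lift z) ∂(μ t) := fun t f hf =>
    integral_map measurable_lift.aemeasurable hf.aestronglyMeasurable
  refine ⟨fun t ht => ?_, fun t ht => ?_, fun B L f hf => ?_, fun B L A f hf t ht => ?_⟩
  · have := hfin t ht
    infer_instance
  · rw [Measure.map_apply measurable_lift
      ((Metric.isClosed_closedBall.prod (Metric.isClosed_closedBall.prod
        isClosed_Icc)).measurableSet.compl)]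
    refine measure_mono_null (t := (box d P θm θM)ᶜ) (fun z hz hb => hz ?_)
      (measure_compl_box (hs t ht))
    exact ⟨mem_closedBall_zero_iff.2 (norm_torusSec_le z.1), hb.1, hb.2⟩
  · simp only [hmap _ f hf.continuous]
    exact hμ.continuousOn_lift hP hθm hs hf
  · have h0T : (0 : ℝ) ∈ Icc 0 T := ⟨le_rfl, ht.1.trans ht.2.le⟩
    have heq := hμ.equation _ (isTest_testFun (θM := θM) hP hθm ht hf.contDiff hf.periodic) t ht
    have hval : ∀ s ∈ Icc 0 t, ∫ z, testFun hP θM hθm ht f s z ∂(μ s)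
        = ∫ z, f (lift z) ∂(μ s) := by
      intro s hst
      have h1 : timeCut ht s = 1 := (timeCut_eventually_eq ht hst).self_of_nhds
      simp only [testFun, h1, one_mul]
      exact integral_cutoff_lift hP hθm f (measure_compl_box (hs s ⟨hst.1, hst.2.trans ht.2.le⟩))
    rw [hval t ⟨ht.1, le_rfl⟩, hval 0 ⟨le_rfl, ht.1⟩] at heq
    rw [hmap _ f hf.continuous, hmap _ f hf.continuous, heq]
    refine intervalIntegral.integral_congr fun s hst => ?_
    rw [uIcc_of_le ht.1] at hst
    have hsT : s ∈ Icc 0 T := ⟨hst.1, hst.2.trans ht.2.le⟩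
    have := hfin s hsT
    have hnull := measure_compl_box (hs s hsT)
    have hcont : Continuous fun q => fderiv ℝ f q (field (drift d hP)
        (fun z w => kern φ ζ hP θm (z, w)) ((μ s).map lift) q) :=
      hf.continuous_fderiv.clm_apply (hk.field_isBL le_rfl).continuous
    change _ = ∫ q, fderiv ℝ f q (field (drift d hP)
        (fun z w => kern φ ζ hP θm (z, w)) ((μ s).map lift) q) ∂((μ s).map lift)
    rw [hmap s _ hcont]
    have hae : ∀ᵐ w ∂(μ s), w ∈ box d P θm θM := hnull
    refine integral_congr_ae (hae.mono fun z hz => ?_)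
    change _ = fderiv ℝ f (lift z) _
    rw [field_lift hP hk hnull hz]
    exact generator_testFun hP hθm ht hf.contDiff hf.periodic hst hz _ _ _

/-- Functions of the bounded Lipschitz class, pulled back to the cover. -/
theorem isBL_of_mem_blClass (hθm : 0 < θm) {g : Phase d → ℝ} (hg : g ∈ blClass d) :
    IsBL (periods d) 1 2 (fun q : Cover d =>
      g (toTorus q.1, q.2.1, ⟨max q.2.2 θm, hθm.trans_le (le_max_right _ _)⟩)) := by
  refine ⟨fun q => hg.1 _, fun q q' => (hg.2 _ _).trans ?_, fun p hp q => ?_⟩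
  · have h1 : ‖q.1 - q'.1‖ ≤ ‖q - q'‖ := norm_fst_le (q - q')
    have h2 : ‖q.2.1 - q'.2.1‖ ≤ ‖q - q'‖ :=
      (norm_fst_le (q - q').2).trans (norm_snd_le (q - q'))
    have h3 : |max q.2.2 θm - max q'.2.2 θm| ≤ ‖q - q'‖ :=
      (abs_max_sub_max_le_abs _ _ _).trans
        ((norm_snd_le (q - q').2).trans (norm_snd_le (q - q')))
    have h4 : ∑ i, ‖toTorus q.1 i - toTorus q'.1 i‖ ^ 2 ≤ ‖q.1 - q'.1‖ ^ 2 := by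
      rw [EuclideanSpace.norm_sq_eq]
      refine Finset.sum_le_sum fun i _ => ?_
      gcongr
      exact norm_coe_unitAddCircle_le ((q.1 - q'.1) i)
    -- Three squares, each at most `‖q - q'‖²`, give the constant `√3`, rounded up to `2`.
    refine Real.sqrt_le_iff.2 ⟨by positivity, ?_⟩
    have h5 := pow_le_pow_left₀ (norm_nonneg _) h1 2
    have h6 := pow_le_pow_left₀ (norm_nonneg _) h2 2
    have h7 := pow_le_pow_left₀ (abs_nonneg _) h3 2
    rw [sq_abs] at h7
    simp only
    nlinarith [sq_nonneg ‖q - q'‖]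
  · have h2 : (q + p).2 = q.2 := by rw [Prod.snd_add, hp.2, add_zero]
    have h1 : toTorus (q + p).1 = toTorus q.1 := by
      rw [Prod.fst_add, toTorus_add, hp.1, add_zero]
    simp only [h1, h2]

end Translation

end TCS

/-! ### The stability estimate on the phase space -/

theorem proposition3p1 (d : ℕ) (φ ζ : UnitAddTorus (Fin d) → ℝ)
    (hφ : ∃ K : ℝ≥0, LipschitzWith K φ) (hζ : ∃ K : ℝ≥0, LipschitzWith K ζ)
    (T P θm θM : ℝ) (hT : 0 < T) (hP : 0 < P) (hθm : 0 < θm) (hθM : 0 < θM) (M : ℝ≥0) :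
    ∃ C : ℝ, 0 < C ∧ ∀ μ ν : ℝ → Measure (TCS.Phase d),
      TCS.IsMeasureValuedSolution φ ζ T μ → TCS.IsMeasureValuedSolution φ ζ T ν →
      (∀ t ∈ Icc 0 T, (μ t).support ⊆ TCS.box d P θm θM) →
      (∀ t ∈ Icc 0 T, (ν t).support ⊆ TCS.box d P θm θM) →
      μ 0 univ ≤ M → ν 0 univ ≤ M →
      ∀ t ∈ Icc 0 T,
        TCS.blDist (μ t) (ν t) ≤ ENNReal.ofReal C * TCS.blDist (μ 0) (ν 0) := by
  obtain ⟨B, L, hk⟩ := TCS.exists_isKernel hφ hζ hP hθm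
  set E := Real.exp ((3 * (L * (1 + M)) + (L * (1 + M)) ^ 2 + (B + L) * M) * T)
  -- The factor `3 = 1 + 2` is the sup bound plus the Lipschitz constant of a test function pulled
  -- back to the cover.
  refine ⟨3 * E, by positivity, fun μ ν hμ hν hsμ hsν hMμ hMν t ht => ?_⟩
  rcases eq_or_ne (TCS.blDist (μ 0) (ν 0)) ⊤ with htop | hfin
  · rw [htop, ENNReal.mul_top (by simpa using by positivity)]
    exact le_top
  have hmass : ∀ p : Measure (TCS.Phase d), p univ ≤ M →
      (p.map TCS.lift).real univ ≤ (M : ℝ) := by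
    intro p hp
    rw [measureReal_def, Measure.map_apply TCS.measurable_lift MeasurableSet.univ, preimage_univ]
    exact ENNReal.toReal_mono ENNReal.coe_ne_top hp
  have hmap : ∀ (p : Measure (TCS.Phase d)) (f : TCS.Cover d → ℝ), Continuous f →
      ∫ q, f q ∂(p.map TCS.lift) = ∫ z, f (TCS.lift z) ∂p := fun p f hf =>
    integral_map TCS.measurable_lift.aemeasurable hf.aestronglyMeasurable
  set D := (TCS.blDist (μ 0) (ν 0)).toReal with hD
  have hD0 : TCS.BLBound (TCS.periods d) ((μ 0).map TCS.lift) ((ν 0).map TCS.lift) D := by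
    intro f hf
    rw [hmap _ f hf.continuous, hmap _ f hf.continuous]
    refine (ENNReal.ofReal_le_iff_le_toReal hfin).1 ?_
    exact le_iSup₂ (f := fun g (_ : g ∈ TCS.blClass d) =>
      ENNReal.ofReal |∫ z, g z ∂(μ 0) - ∫ z, g z ∂(ν 0)|) (fun z => f (TCS.lift z))
      ⟨fun z => hf.norm_le _, fun z z' => by
        simpa using TCS.abs_lift_sub_le hf zero_le_one z z'⟩
  have hstab := (hμ.isWeakSol hP hθm hsμ hk).stability (hν.isWeakSol hP hθm hsν hk) hk
    ((isCompact_closedBall _ _).prod ((isCompact_closedBall _ _).prod isCompact_Icc)) hT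
    (hmass _ hMμ) (hmass _ hMν) hD0 ht
  refine iSup₂_le fun g hg => ?_
  have hf := TCS.isBL_of_mem_blClass hθm hg
  have hbound := hstab.apply hf zero_le_two
  rw [hmap _ _ hf.continuous, hmap _ _ hf.continuous] at hbound
  -- On the box the maximum with `θm` is inactive, so lifting and projecting returns the original
  -- point.
  have hg' : ∀ p : Measure (TCS.Phase d), p (TCS.box d P θm θM)ᶜ = 0 →
      ∫ z, g (TCS.toTorus (TCS.lift z).1, (TCS.lift z).2.1,
        ⟨max (TCS.lift z).2.2 θm, hθm.trans_le (le_max_right _ _)⟩) ∂p = ∫ z, g z ∂p := by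
    intro p hp
    have hae : ∀ᵐ z ∂p, z ∈ TCS.box d P θm θM := hp
    refine integral_congr_ae (hae.mono fun z hz => ?_)
    have e : (⟨max (TCS.lift z).2.2 θm, hθm.trans_le (le_max_right _ _)⟩ : Ioi (0 : ℝ))
        = z.2.2 := Subtype.ext (max_eq_left hz.2.1)
    simp only [e]
    simp only [TCS.lift, TCS.toTorus_torusSec]
  rw [hg' _ (TCS.measure_compl_box (hsμ t ht)), hg' _ (TCS.measure_compl_box (hsν t ht))]
    at hbound
  rw [← ENNReal.ofReal_toReal hfin, ← hD, ← ENNReal.ofReal_mul (by positivity)]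
  exact ENNReal.ofReal_le_ofReal (hbound.trans_eq (by ring))
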